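/- Let $M$ be a countable first-order structure and $G=\mathrm{Aut}(M)$; for $X\subseteq M$ let $\mathrm{Aut}(M/X)=G_X$ be the pointwise stabilizer of $X$, and let $\mathrm{orb}(b/X)$ be the $G_X$-orbit of $b$. Let $d$ be a non-zero integer-valued dimension function on $M$, that is, a function from the finite subsets of $M$ to $\mathbb{Z}$, not identically zero, with $d(\emptyset)=0$, $d(gX)=d(X)$ and $0\le d(X)\le d(X\cup Y)\le d(X)+d(Y)-d(X\cap Y)$ for all finite $X,Y\subseteq M$ and $g\in G$. For finite $X$ and arbitrary $Z\subseteq M$ put $d(X/Z)=\min\{d(X\cup Y)-d(Y): Y\subseteq Z \text{ finite}\}$; for an arbitrary set $A$ let $d(A/Z)$ be the maximum of $d(X/Z)$ over the finite $X\subseteq A$ (used only where this maximum exists). Put $\mathrm{cl}^d(Z)=\{a\in M: d(a/Z)=0\}$ and $\mathcal{X}=\{\mathrm{cl}^d(X): X\subseteq M\text{ finite}\}$. For $A,B,C$ each in $\mathcal{X}$ or finite, write $A\perp^d_B C$ if $d(A/B\cup C)=d(A/B)$. Assume: 1. $\mathrm{cl}^d$ subsumes definable closure: if $X\subseteq M$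 is finite and $a\in M$ is fixed by $G_{\mathrm{cl}^d(X)}$, then $a\in \mathrm{cl}^d(X)$. 2. Existence: for all $A,B,C\in\mathcal{X}$ there is $g\in G_B$ with $gA\perp^d_B C$. 3. $\perp^d$ is stationary: if $A_1,A_2,B,C\in\mathcal{X}$, $B\subseteq A_i$ and $A_i\perp^d_B C$ for $i=1,2$, and $h:A_1\to A_2$ is a bijection that is the identity on $B$ and extends to an automorphism of $M$, then $h\cup \mathrm{id}_C$ extends to an automorphism of $M$. For $A\in\mathcal{X}$ say that $b\in M$ is basic over $A$ if $b\notin A$ and, whenever $A\subseteq C\in\mathcal{X}$ and $d(b/C)<d(b/A)$, then $b\in C$. Say that $h\in G$ is unbounded if there is $A_0\in\mathcal{X}$ such that for all $C\in\mathcal{X}$ with $A_0\subseteq C$ and all $b\in M$ basic over $C$ there is $b'\in\mathrm{orb}(b/C)$ with $hb'\perp^d_C b'$. Suppose that for some $A\in\mathcal{X}$ there is a $G_A$-invariant set $D\subseteq M$ such that all elements of $D\setminus A$ are basic over $A$ and $\mathrm{cl}^d(D\cup A)=M$. Let $g\in\mathrm{Aut}(M/\mathrm{cl}^d(\emptyset))$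 be unbounded. Then every element of $\mathrm{Aut}(M/\mathrm{cl}^d(\emptyset))$ is a product of $96$ elements, each of which is conjugate to $g$ or to $g^{-1}$ in $\mathrm{Aut}(M/\mathrm{cl}^d(\emptyset))$. -/

import Mathlib

universe u v w

/-- The automorphism group of a first-order structure, under composition. -/
instance autGroup {L : FirstOrder.Language.{u, v}} {M : Type w} [L.Structure M] :
    Group (L.Equiv M M) where
  mul f g := f.comp g
  one := FirstOrder.Language.Equiv.refl L M
  inv f := f.symm
  mul_assoc f g h := FirstOrder.Language.Equiv.comp_assoc h g f
  one_mul f := FirstOrder.Language.Equiv.refl_comp f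
  mul_one f := FirstOrder.Language.Equiv.comp_refl f
  inv_mul_cancel f := FirstOrder.Language.Equiv.symm_comp_self f

/-- Automorphisms of a structure act on its domain by evaluation. -/
instance autAction {L : FirstOrder.Language.{u, v}} {M : Type w} [L.Structure M] :
    MulAction (L.Equiv M M) M where
  smul f x := f x
  one_smul x := FirstOrder.Language.Equiv.refl_apply x
  mul_smul f g x := FirstOrder.Language.Equiv.comp_apply f g x

namespace DimensionIndependence

section Dimension

variable {M : Type*} [DecidableEq M]

/-- `d(X/Z) = min {d(X ∪ Y) - d(Y) : Y a finite subset of Z}`, for finite `X` and arbitrary `Z`.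
For a dimension function the integers concerned are nonnegative, so that the minimum exists. -/
noncomputable def relDim (d : Finset M → ℤ) (X : Finset M) (Z : Set M) : ℤ :=
  sInf {n : ℤ | ∃ Y : Finset M, (Y : Set M) ⊆ Z ∧ n = d (X ∪ Y) - d Y}

/-- `d(A/Z)` for an arbitrary set `A`: the maximum of `d(X/Z)` over the finite subsets `X` of `A`.
The maximum exists whenever `A` lies in the `d`-closure of a finite set. -/
noncomputable def setDim (d : Finset M → ℤ) (A Z : Set M) : ℤ :=
  sSup {n : ℤ | ∃ X : Finset M, (X : Set M) ⊆ A ∧ n = relDim d X Z}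

/-- The `d`-closure `cl^d(Z) = {a : d(a/Z) = 0}`. -/
def dcl (d : Finset M → ℤ) (Z : Set M) : Set M :=
  {a : M | relDim d {a} Z = 0}

/-- The collection of all `d`-closures of finite subsets of `M`. -/
def finClosures (d : Finset M → ℤ) : Set (Set M) :=
  {A : Set M | ∃ X : Finset M, A = dcl d (X : Set M)}

/-- `d`-independence of `A` and `C` over `B`: `d(A/B ∪ C) = d(A/B)`. -/
def Indep (d : Finset M → ℤ) (A B C : Set M) : Prop :=
  setDim d A (B ∪ C) = setDim d A B

/-- `b` is basic over `A`. -/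
def IsBasic (d : Finset M → ℤ) (A : Set M) (b : M) : Prop :=
  b ∉ A ∧ ∀ C ∈ finClosures d, A ⊆ C → relDim d {b} C < relDim d {b} A → b ∈ C

end Dimension

section Group

/-! The notions below depend on a group `G` of permutations of `M`, which is the automorphism
group when `M` is a first-order structure. For a set `B`, the subgroup `fixingSubgroup G B` is the
pointwise stabilizer of `B` in `G`. -/

variable (G : Type*) {M : Type*} [DecidableEq M] [Group G] [MulAction G M]

/-- A `G`-invariant integer-valued dimension function on the finite subsets of `M`, normalized
to vanish on the empty set. -/
structure IsDimensionFunction (d : Finset M → ℤ) : Prop where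
  invariant : ∀ (g : G) (X : Finset M), d (X.image (fun x => g • x)) = d X
  nonneg : ∀ X : Finset M, 0 ≤ d X
  mono : ∀ X Y : Finset M, d X ≤ d (X ∪ Y)
  submodular : ∀ X Y : Finset M, d (X ∪ Y) ≤ d X + d Y - d (X ∩ Y)
  empty : d ∅ = 0

/-- `d`-closure subsumes definable closure: for finite `X`, every point fixed by the pointwise
stabilizer of `cl^d(X)` belongs to `cl^d(X)`. -/
def SubsumesDefinableClosure (d : Finset M → ℤ) : Prop :=
  ∀ (X : Finset M) (a : M),
    (∀ g ∈ fixingSubgroup G (dcl d (X : Set M)), g • a = a) → a ∈ dcl d (X : Set M)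

/-- Existence for `d`-independence. -/
def HasExistence (d : Finset M → ℤ) : Prop :=
  ∀ A ∈ finClosures d, ∀ B ∈ finClosures d, ∀ C ∈ finClosures d,
    ∃ g ∈ fixingSubgroup G B, Indep d ((fun x => g • x) '' A) B C

/-- Stationarity for `d`-independence. A partial automorphism is a bijection between two `d`-closures
of finite sets that extends to an element of `G`, so the partial automorphism from `A₁` to `A₂`
is given here by such an extension `h`, and the one extending it together with the identity
of `C` is the restriction of `k` to the `d`-closure of `A₁ ∪ C`. -/
def IsStationary (d : Finset M → ℤ) : Prop :=
  ∀ A₁ ∈ finClosures d, ∀ A₂ ∈ finClosures d, ∀ B ∈ finClosures d, ∀ C ∈ finClosures d,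
    B ⊆ A₁ → B ⊆ A₂ → Indep d A₁ B C → Indep d A₂ B C →
    ∀ h : G, (fun x => h • x) '' A₁ = A₂ → (∀ x ∈ B, h • x = x) →
      ∃ k : G, (∀ x ∈ A₁, k • x = h • x) ∧ ∀ x ∈ C, k • x = x

variable {G}

/-- `h` is unbounded over `A`: whenever `b` is basic over some `C ⊇ A`, there is `b'` in the orbit of
`b` over `C` such that `h b'` and `b'` are `d`-independent over `C`. -/
def IsUnboundedOver (d : Finset M → ℤ) (A : Set M) (h : G) : Prop :=
  ∀ C ∈ finClosures d, A ⊆ C → ∀ b : M, IsBasic d C b →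
    ∃ b' ∈ MulAction.orbit (fixingSubgroup G C) b, Indep d {h • b'} C {b'}

/-- `h` is unbounded: it is unbounded over the `d`-closure of some finite set. -/
def IsUnbounded (d : Finset M → ℤ) (h : G) : Prop :=
  ∃ A ∈ finClosures d, IsUnboundedOver d A h

end Group

end DimensionIndependence

/-! Independence is equality in a submodularity inequality for the rank `rk` of sets of finite
dimension, so every independence argument becomes linear arithmetic with ranks.

Unboundedness speaks of single basic points. Since `D` consists of points basic over `A` or lying in
`A`, and generates `M` over `A`, it upgrades to all types: over any sufficiently large X, every type
has a realization as independent from its `g`-image as X and gX permit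
(`IsUnboundedOver.movesMaximally`).

Stationarity then lets a conjugate of such a `g` induce any prescribed partial automorphism whose
source and target are independent enough (`MovesMaximally.exists_conj_eq`). With four conjugates the
independence requirement disappears: the outer two move source and target into general position, the
inner two join them. So, after a small change of the conjugators, the product of four conjugates is
locally dense in `G` (`conjProd_dense`). Neighbourhoods here are given by pointwise stabilizers of
sets of finite dimension.

Exact equality comes from a back-and-forth. Put P u = `conjProd g u` and Q v = k (P v)⁻¹. Once P and
Q agree on a set beyond which Q is locally dense, u and v are corrected alternately and converge to
a solution of P u = Q v (`SomewhereDense.exists_eq`). Hence eight conjugates of `g` suffice for any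
k, and 88 further copies of `g` bring the length to 96. -/

namespace DimensionIndependence

open scoped Pointwise
open Filter


/-! ### Rank calculus for sets of finite dimension. -/

section Rank

variable {G : Type*} {M : Type*} [Group G] [MulAction G M] {d : Finset M → ℤ}

/-- The set `S` has finite dimension. -/
def FinDim (d : Finset M → ℤ) (S : Set M) : Prop :=
  BddAbove {n : ℤ | ∃ X : Finset M, (X : Set M) ⊆ S ∧ n = d X}

/-- The dimension of a set of finite dimension. -/
noncomputable def rk (d : Finset M → ℤ) (S : Set M) : ℤ :=
  sSup {n : ℤ | ∃ X : Finset M, (X : Set M) ⊆ S ∧ n = d X}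

theorem FinDim.mono {S T : Set M} (hT : FinDim d T) (h : S ⊆ T) : FinDim d S :=
  BddAbove.mono (by rintro _ ⟨X, hX, hn⟩; exact ⟨X, hX.trans h, hn⟩) hT

theorem FinDim.le_rk {S : Set M} (hS : FinDim d S) {X : Finset M} (hX : (X : Set M) ⊆ S) :
    d X ≤ rk d S :=
  le_csSup hS ⟨X, hX, rfl⟩

theorem FinDim.exists_rk {S : Set M} (hS : FinDim d S) :
    ∃ X : Finset M, (X : Set M) ⊆ S ∧ d X = rk d S := by
  obtain ⟨X, hX, h⟩ := Int.csSup_mem (s := {n : ℤ | ∃ X : Finset M, (X : Set M) ⊆ S ∧ n = d X})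
    ⟨_, ∅, by simp, rfl⟩ hS
  exact ⟨X, hX, h.symm⟩

theorem FinDim.rk_mono {S T : Set M} (hT : FinDim d T) (h : S ⊆ T) : rk d S ≤ rk d T := by
  obtain ⟨X, hX, e⟩ := (hT.mono h).exists_rk
  exact e ▸ hT.le_rk (hX.trans h)

theorem smul_set_eq_of_fixing {X : Set M} {a : G} (ha : a ∈ fixingSubgroup G X) : a • X = X := by
  rw [mem_fixingSubgroup_iff] at ha
  have : a • X = (fun x => x) '' X := Set.image_congr fun x hx => ha x hx
  simpa using this

theorem fixingSubgroup_le {X Y : Set M} (h : X ⊆ Y) : fixingSubgroup G Y ≤ fixingSubgroup G X :=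
  fun _ ha => (mem_fixingSubgroup_iff G).2 fun x hx => (mem_fixingSubgroup_iff G).1 ha x (h hx)

variable [DecidableEq M]

theorem IsDimensionFunction.le_of_subset (hd : IsDimensionFunction G d) {X Y : Finset M}
    (h : X ⊆ Y) : d X ≤ d Y := by
  have := hd.mono X Y
  rwa [Finset.union_eq_right.2 h] at this

theorem IsDimensionFunction.finDim_finset (hd : IsDimensionFunction G d) (X : Finset M) :
    FinDim d (X : Set M) :=
  ⟨d X, by rintro _ ⟨Y, hY, rfl⟩; exact hd.le_of_subset (by exact_mod_cast hY)⟩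

theorem IsDimensionFunction.finDim_finite (hd : IsDimensionFunction G d) {S : Set M}
    (h : S.Finite) : FinDim d S := by
  simpa using hd.finDim_finset h.toFinset

theorem IsDimensionFunction.rk_finset (hd : IsDimensionFunction G d) (X : Finset M) :
    rk d (X : Set M) = d X := by
  apply le_antisymm
  · obtain ⟨Y, hY, e⟩ := (hd.finDim_finset X).exists_rk
    exact e ▸ hd.le_of_subset (by exact_mod_cast hY)
  · exact (hd.finDim_finset X).le_rk le_rfl

theorem exists_finset_split {S T : Set M} {Z : Finset M} (hZ : (Z : Set M) ⊆ S ∪ T) :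
    ∃ X Y : Finset M, (X : Set M) ⊆ S ∧ (Y : Set M) ⊆ T ∧ Z = X ∪ Y := by
  classical
  refine ⟨Z.filter (· ∈ S), Z.filter (· ∈ T), fun x => ?_, fun x => ?_, ?_⟩
  · simp
  · simp
  ext x
  simp only [Finset.mem_union, Finset.mem_filter]
  have : x ∈ Z → x ∈ S ∨ x ∈ T := fun h => hZ h
  tauto

theorem IsDimensionFunction.finDim_union (hd : IsDimensionFunction G d) {S T : Set M}
    (hS : FinDim d S) (hT : FinDim d T) : FinDim d (S ∪ T) := by
  refine ⟨rk d S + rk d T, ?_⟩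
  rintro _ ⟨Z, hZ, rfl⟩
  obtain ⟨X, Y, hX, hY, rfl⟩ := exists_finset_split hZ
  have := hd.submodular X Y
  have := hd.nonneg (X ∩ Y)
  have := hS.le_rk hX
  have := hT.le_rk hY
  linarith

theorem IsDimensionFunction.rk_submodular (hd : IsDimensionFunction G d) {S T U : Set M}
    (hS : FinDim d S) (hT : FinDim d T) (hUS : U ⊆ S) (hUT : U ⊆ T) :
    rk d (S ∪ T) + rk d U ≤ rk d S + rk d T := by
  obtain ⟨Z, hZ, e⟩ := (hd.finDim_union hS hT).exists_rk
  obtain ⟨W, hW, e'⟩ := (hS.mono hUS).exists_rk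
  obtain ⟨X, Y, hX, hY, rfl⟩ := exists_finset_split hZ
  -- Adding `W`, which carries the rank of `U`, to both halves forces their intersection to have at
  -- least that rank.
  have h1 := hd.submodular (X ∪ W) (Y ∪ W)
  have h2 : d W ≤ d ((X ∪ W) ∩ (Y ∪ W)) := hd.le_of_subset (by
    intro x; simp; tauto)
  have h3 : d (X ∪ Y) ≤ d (X ∪ W ∪ (Y ∪ W)) := hd.le_of_subset (by
    intro x; simp; tauto)
  have h4 := hS.le_rk (X := X ∪ W) (by simpa using ⟨hX, hW.trans hUS⟩)
  have h5 := hT.le_rk (X := Y ∪ W) (by simpa using ⟨hY, hW.trans hUT⟩)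
  linarith

theorem IsDimensionFunction.finDim_smul (hd : IsDimensionFunction G d) {S : Set M}
    (hS : FinDim d S) (g : G) : FinDim d (g • S) := by
  refine ⟨rk d S, ?_⟩
  rintro _ ⟨X, hX, rfl⟩
  rw [← hd.invariant g⁻¹ X]
  apply hS.le_rk
  rw [Finset.coe_image]
  rintro _ ⟨x, hx, rfl⟩
  exact Set.mem_smul_set_iff_inv_smul_mem.1 (hX hx)

theorem IsDimensionFunction.rk_smul (hd : IsDimensionFunction G d) {S : Set M}
    (hS : FinDim d S) (g : G) : rk d (g • S) = rk d S := by
  have key : ∀ (S : Set M) (g : G), FinDim d S → rk d S ≤ rk d (g • S) := by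
    intro S g hS
    obtain ⟨X, hX, e⟩ := hS.exists_rk
    rw [← e, ← hd.invariant g X]
    apply (hd.finDim_smul hS g).le_rk
    rw [Finset.coe_image]
    rintro _ ⟨x, hx, rfl⟩
    exact Set.smul_mem_smul_set (hX hx)
  refine le_antisymm ?_ (key S g hS)
  simpa using key (g • S) g⁻¹ (hd.finDim_smul hS g)

theorem IsDimensionFunction.relDim_eq (hd : IsDimensionFunction G d) (X : Finset M) {Z : Set M}
    (hZ : FinDim d Z) : relDim d X Z = rk d (X ∪ Z) - rk d Z := by
  have hXZ := hd.finDim_union (hd.finDim_finset X) hZ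
  obtain ⟨Y, hY, eY⟩ := hZ.exists_rk
  obtain ⟨W, hW, eW⟩ := hXZ.exists_rk
  obtain ⟨W₁, W₂, h₁, h₂, rfl⟩ := exists_finset_split hW
  have hYW : ((Y ∪ W₂ : Finset M) : Set M) ⊆ Z := by simpa using ⟨hY, h₂⟩
  apply IsLeast.csInf_eq
  constructor
  -- This set carries the rank of `Z` and, joined with `X`, that of `X ∪ Z`; submodularity shows
  -- that no other finite subset of `Z` does better.
  · refine ⟨Y ∪ W₂, hYW, ?_⟩
    have e1 : d (Y ∪ W₂) = rk d Z :=
      le_antisymm (hZ.le_rk hYW) (eY ▸ hd.le_of_subset Finset.subset_union_left)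
    have e2 : d (X ∪ (Y ∪ W₂)) = rk d (X ∪ Z) := by
      refine le_antisymm (hXZ.le_rk ?_) (eW ▸ hd.le_of_subset ?_)
      · rw [Finset.coe_union]
        exact Set.union_subset_union_right _ hYW
      · intro x hx
        have : x ∈ W₁ → x ∈ X := fun h => by exact_mod_cast h₁ h
        simp at hx ⊢
        tauto
    rw [e1, e2]
  · rintro _ ⟨V, hV, rfl⟩
    have := hd.rk_submodular (hd.finDim_finset (X ∪ V)) hZ (U := (V : Set M)) (by simp) hV
    rw [hd.rk_finset, hd.rk_finset] at this
    have h3 : rk d ((X : Set M) ∪ Z) ≤ rk d (((X ∪ V : Finset M) : Set M) ∪ Z) :=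
      (hd.finDim_union (hd.finDim_finset _) hZ).rk_mono (by
        intro x; simp; tauto)
    linarith

theorem IsDimensionFunction.setDim_eq (hd : IsDimensionFunction G d) {A Z : Set M}
    (hA : FinDim d A) (hZ : FinDim d Z) : setDim d A Z = rk d (A ∪ Z) - rk d Z := by
  have hAZ := hd.finDim_union hA hZ
  obtain ⟨W, hW, eW⟩ := hAZ.exists_rk
  obtain ⟨W₁, W₂, h₁, h₂, rfl⟩ := exists_finset_split hW
  have hW₁ : (W₁ : Set M) ∪ Z ⊆ A ∪ Z := Set.union_subset_union_left _ h₁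
  apply IsGreatest.csSup_eq
  constructor
  · refine ⟨W₁, h₁, ?_⟩
    rw [hd.relDim_eq _ hZ]
    congr 1
    refine le_antisymm ?_ (hAZ.rk_mono hW₁)
    rw [← eW]
    apply (hAZ.mono hW₁).le_rk
    rw [Finset.coe_union]
    exact Set.union_subset_union_right _ h₂
  · rintro _ ⟨X, hX, rfl⟩
    rw [hd.relDim_eq _ hZ]
    exact sub_le_sub_right (hAZ.rk_mono (Set.union_subset_union_left _ hX)) _

/-- The reverse inequality always holds by submodularity, so independence may be used in this
one-sided form, symmetric in `A` and `C`. -/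
theorem IsDimensionFunction.indep_iff (hd : IsDimensionFunction G d) {A B C : Set M}
    (hA : FinDim d A) (hB : FinDim d B) (hC : FinDim d C) :
    Indep d A B C ↔ rk d (A ∪ B) + rk d (B ∪ C) ≤ rk d (A ∪ B ∪ C) + rk d B := by
  have h := hd.rk_submodular (hd.finDim_union hA hB) (hd.finDim_union hB hC) (U := B)
    (by simp) (by simp)
  have e : A ∪ B ∪ (B ∪ C) = A ∪ B ∪ C := by ext; simp; tauto
  rw [e] at h
  rw [Indep, hd.setDim_eq hA hB, hd.setDim_eq hA (hd.finDim_union hB hC), ← Set.union_assoc]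
  constructor <;> intro <;> linarith

theorem IsDimensionFunction.mem_dcl_iff (hd : IsDimensionFunction G d) {S : Set M} {a : M} :
    a ∈ dcl d S ↔ ∃ Y : Finset M, (Y : Set M) ⊆ S ∧ d ({a} ∪ Y) = d Y := by
  constructor
  · intro h
    have hm := Int.csInf_mem
      (s := {n : ℤ | ∃ Y : Finset M, (Y : Set M) ⊆ S ∧ n = d ({a} ∪ Y) - d Y})
      ⟨_, ∅, by simp, rfl⟩ ⟨0, by
        rintro _ ⟨Y, -, rfl⟩
        have := hd.le_of_subset (X := Y) (Y := {a} ∪ Y) Finset.subset_union_right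
        linarith⟩
    obtain ⟨Y, hY, e⟩ := hm
    have h' : relDim d {a} S = 0 := h
    refine ⟨Y, hY, ?_⟩
    rw [relDim] at h'
    linarith
  · rintro ⟨Y, hY, e⟩
    change relDim d {a} S = 0
    apply IsLeast.csInf_eq
    refine ⟨⟨Y, hY, by rw [e, sub_self]⟩, ?_⟩
    rintro _ ⟨Y, -, rfl⟩
    have := hd.le_of_subset (X := Y) (Y := {a} ∪ Y) Finset.subset_union_right
    linarith

theorem IsDimensionFunction.mem_dcl_iff_rk (hd : IsDimensionFunction G d) {S : Set M} {a : M}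
    (hS : FinDim d S) : a ∈ dcl d S ↔ rk d ({a} ∪ S) = rk d S := by
  change relDim d {a} S = 0 ↔ _
  rw [hd.relDim_eq _ hS, Finset.coe_singleton, sub_eq_zero]

theorem IsDimensionFunction.subset_dcl (hd : IsDimensionFunction G d) (S : Set M) :
    S ⊆ dcl d S := fun a ha =>
  hd.mem_dcl_iff.2 ⟨{a}, by simpa, by simp⟩

theorem IsDimensionFunction.dcl_mono (hd : IsDimensionFunction G d) {S T : Set M} (h : S ⊆ T) :
    dcl d S ⊆ dcl d T := fun _ ha =>
  let ⟨Y, hY, e⟩ := hd.mem_dcl_iff.1 ha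
  hd.mem_dcl_iff.2 ⟨Y, hY.trans h, e⟩

theorem IsDimensionFunction.rk_union_of_subset_dcl (hd : IsDimensionFunction G d) {S : Set M}
    (hS : FinDim d S) (W : Finset M) (hW : (W : Set M) ⊆ dcl d S) :
    rk d (W ∪ S) = rk d S := by
  induction W using Finset.induction_on with
  | empty => simp
  | insert a W _ ih =>
    rw [Finset.coe_insert, Set.insert_subset_iff] at hW
    have e := ih hW.2
    have ea := (hd.mem_dcl_iff_rk hS).1 hW.1
    have hWS := hd.finDim_union (hd.finDim_finset W) hS
    have haS := hd.finDim_union (hd.finDim_finite (Set.finite_singleton a)) hS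
    have h := hd.rk_submodular haS hWS (U := S) (by simp) (by simp)
    have e' : ({a} ∪ S) ∪ (↑W ∪ S) = ↑(insert a W) ∪ S := by ext; simp; tauto
    rw [e'] at h
    apply le_antisymm
    · linarith
    · exact (hd.finDim_union (hd.finDim_finset _) hS).rk_mono (by simp)

theorem IsDimensionFunction.finDim_dcl (hd : IsDimensionFunction G d) {S : Set M}
    (hS : FinDim d S) : FinDim d (dcl d S) := by
  refine ⟨rk d S, ?_⟩
  rintro _ ⟨X, hX, rfl⟩
  rw [← hd.rk_union_of_subset_dcl hS X hX]
  exact (hd.finDim_union (hd.finDim_finset _) hS).le_rk (by simp)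

theorem IsDimensionFunction.rk_dcl (hd : IsDimensionFunction G d) {S : Set M}
    (hS : FinDim d S) : rk d (dcl d S) = rk d S := by
  apply le_antisymm
  · obtain ⟨X, hX, e⟩ := (hd.finDim_dcl hS).exists_rk
    rw [← e, ← hd.rk_union_of_subset_dcl hS X hX]
    exact (hd.finDim_union (hd.finDim_finset _) hS).le_rk (by simp)
  · exact (hd.finDim_dcl hS).rk_mono (hd.subset_dcl S)

/-- Sets with the same closure over which the rank of unions can be exchanged. -/
theorem IsDimensionFunction.rk_union_eq (hd : IsDimensionFunction G d) {S S' T : Set M}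
    (hS' : FinDim d S') (hT : FinDim d T) (h : S ⊆ S') (e : rk d S' = rk d S) :
    rk d (S' ∪ T) = rk d (S ∪ T) := by
  have h1 := hd.rk_submodular hS' (hd.finDim_union (hS'.mono h) hT) (U := S) h (by simp)
  have e' : S' ∪ (S ∪ T) = S' ∪ T := by
    rw [← Set.union_assoc, Set.union_eq_left.2 h]
  rw [e'] at h1
  have := (hd.finDim_union hS' hT).rk_mono (Set.union_subset_union_left T h)
  linarith

theorem IsDimensionFunction.rk_dcl_union (hd : IsDimensionFunction G d) {S T : Set M}
    (hS : FinDim d S) (hT : FinDim d T) : rk d (dcl d S ∪ T) = rk d (S ∪ T) :=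
  hd.rk_union_eq (hd.finDim_dcl hS) hT (hd.subset_dcl S) (hd.rk_dcl hS)

theorem IsDimensionFunction.rk_union_dcl (hd : IsDimensionFunction G d) {S T : Set M}
    (hS : FinDim d S) (hT : FinDim d T) : rk d (T ∪ dcl d S) = rk d (T ∪ S) := by
  rw [Set.union_comm, hd.rk_dcl_union hS hT, Set.union_comm]

/-- A finite subset carrying the full rank of `S` already has the same closure. This lets the axioms
for closures of finite sets be applied to all sets of finite dimension. -/
theorem IsDimensionFunction.dcl_mem (hd : IsDimensionFunction G d) {S : Set M}
    (hS : FinDim d S) : dcl d S ∈ finClosures d := by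
  obtain ⟨X, hX, e⟩ := hS.exists_rk
  refine ⟨X, Set.Subset.antisymm (fun a ha => ?_) (hd.dcl_mono hX)⟩
  rw [hd.mem_dcl_iff_rk hS] at ha
  rw [hd.mem_dcl_iff_rk (hd.finDim_finset X)]
  have haS := hd.finDim_union (hd.finDim_finite (Set.finite_singleton a)) hS
  have h1 : rk d ({a} ∪ (X : Set M)) ≤ rk d ({a} ∪ S) :=
    haS.rk_mono (Set.union_subset_union_right _ hX)
  have h2 : rk d (X : Set M) ≤ rk d ({a} ∪ (X : Set M)) :=
    (haS.mono (Set.union_subset_union_right _ hX)).rk_mono (by simp)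
  rw [hd.rk_finset] at h2 ⊢
  linarith

theorem IsDimensionFunction.finDim_of_mem (hd : IsDimensionFunction G d) {S : Set M}
    (hS : S ∈ finClosures d) : FinDim d S := by
  obtain ⟨X, rfl⟩ := hS
  exact hd.finDim_dcl (hd.finDim_finset X)

theorem IsDimensionFunction.smul_dcl (hd : IsDimensionFunction G d) (g : G) (S : Set M) :
    g • dcl d S = dcl d (g • S) := by
  have key : ∀ (g : G) (S : Set M), g • dcl d S ⊆ dcl d (g • S) := by
    rintro g S _ ⟨a, ha, rfl⟩
    obtain ⟨Y, hY, e⟩ := hd.mem_dcl_iff.1 ha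
    refine hd.mem_dcl_iff.2 ⟨Y.image (g • ·), ?_, ?_⟩
    · rw [Finset.coe_image]
      exact Set.smul_set_mono hY
    · rw [hd.invariant, ← e, ← hd.invariant g ({a} ∪ Y), Finset.image_union,
        Finset.image_singleton]
  refine Set.Subset.antisymm (key g S) ?_
  have := Set.smul_set_mono (a := g) (key g⁻¹ (g • S))
  simpa using this

theorem IsDimensionFunction.smul_mem (hd : IsDimensionFunction G d) (g : G) {S : Set M}
    (hS : S ∈ finClosures d) : g • S ∈ finClosures d := by
  obtain ⟨X, rfl⟩ := hS
  rw [hd.smul_dcl]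
  exact hd.dcl_mem (hd.finDim_smul (hd.finDim_finset X) g)

theorem IsDimensionFunction.dcl_eq_self (hd : IsDimensionFunction G d) {S : Set M}
    (hS : S ∈ finClosures d) : dcl d S = S := by
  refine Set.Subset.antisymm (fun a ha => ?_) (hd.subset_dcl S)
  have hS' := hd.finDim_of_mem hS
  obtain ⟨X, rfl⟩ := hS
  have hX := hd.finDim_finset X
  have ha' := hd.finDim_finite (Set.finite_singleton a)
  rw [hd.mem_dcl_iff_rk hS', hd.rk_union_dcl hX ha', hd.rk_dcl hX] at ha
  exact (hd.mem_dcl_iff_rk hX).2 ha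

/-- Existence for arbitrary sets of finite dimension. -/
theorem IsDimensionFunction.exists_indep (hd : IsDimensionFunction G d)
    (hex : HasExistence G d) {A B C : Set M}
    (hA : FinDim d A) (hB : FinDim d B) (hC : FinDim d C) :
    ∃ g ∈ fixingSubgroup G B,
      rk d (A ∪ B) + rk d (B ∪ C) ≤ rk d (g • A ∪ B ∪ C) + rk d B := by
  obtain ⟨g, hg, h⟩ := hex _ (hd.dcl_mem hA) _ (hd.dcl_mem hB) _ (hd.dcl_mem hC)
  have hgB := fixingSubgroup_le (hd.subset_dcl B) hg
  refine ⟨g, hgB, ?_⟩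
  change Indep d (g • dcl d A) _ _ at h
  have hgA := hd.finDim_smul hA g
  rw [hd.smul_dcl, hd.indep_iff (hd.finDim_dcl hgA) (hd.finDim_dcl hB) (hd.finDim_dcl hC),
    hd.rk_dcl hB, hd.rk_dcl_union hB (hd.finDim_dcl hC), hd.rk_union_dcl hC hB,
    hd.rk_dcl_union hgA (hd.finDim_dcl hB), hd.rk_union_dcl hB hgA,
    hd.rk_union_dcl hC (hd.finDim_union (hd.finDim_dcl hgA) (hd.finDim_dcl hB)),
    Set.union_assoc, hd.rk_dcl_union hgA (hd.finDim_union (hd.finDim_dcl hB) hC),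
    Set.union_left_comm, hd.rk_dcl_union hB (hd.finDim_union hgA hC)] at h
  have e : rk d (g • A ∪ B) = rk d (A ∪ B) := by
    rw [← hd.rk_smul (hd.finDim_union hA hB) g, Set.smul_set_union, smul_set_eq_of_fixing hgB]
  rw [e] at h
  rwa [Set.union_comm (g • A) B, Set.union_assoc]

/-- Stationarity for arbitrary sets of finite dimension, over a closed base. -/
theorem IsDimensionFunction.exists_extension (hd : IsDimensionFunction G d)
    (hst : IsStationary G d) {A B C : Set M} (hA : FinDim d A) (hB : B ∈ finClosures d)
    (hC : FinDim d C) (hBA : B ⊆ A) (h : G) (hh : h ∈ fixingSubgroup G B)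
    (h₁ : rk d A + rk d (B ∪ C) ≤ rk d (A ∪ C) + rk d B)
    (h₂ : rk d A + rk d (B ∪ C) ≤ rk d (h • A ∪ C) + rk d B) :
    ∃ k : G, (∀ x ∈ A, k • x = h • x) ∧ k ∈ fixingSubgroup G C := by
  have hB' := hd.finDim_of_mem hB
  have hind : ∀ A, FinDim d A → B ⊆ A → rk d A + rk d (B ∪ C) ≤ rk d (A ∪ C) + rk d B →
      Indep d (dcl d A) B (dcl d C) := by
    intro A hA hBA h
    rw [hd.indep_iff (hd.finDim_dcl hA) hB' (hd.finDim_dcl hC),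
      Set.union_eq_left.2 (hBA.trans (hd.subset_dcl A)), hd.rk_dcl hA,
      hd.rk_union_dcl hC hB', hd.rk_dcl_union hA (hd.finDim_dcl hC), hd.rk_union_dcl hC hA]
    exact h
  have hhA := hd.finDim_smul hA h
  have hBhA : B ⊆ h • A := by
    rw [← smul_set_eq_of_fixing hh]
    exact Set.smul_set_mono hBA
  obtain ⟨k, hk, hk'⟩ := hst _ (hd.dcl_mem hA) _ (hd.dcl_mem hhA) _ hB _ (hd.dcl_mem hC)
    (hBA.trans (hd.subset_dcl A)) (hBhA.trans (hd.subset_dcl _)) (hind A hA hBA h₁)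
    (hind _ hhA hBhA (by rwa [hd.rk_smul hA])) h (hd.smul_dcl h A)
    ((mem_fixingSubgroup_iff G).1 hh)
  exact ⟨k, fun x hx => hk x (hd.subset_dcl A hx),
    (mem_fixingSubgroup_iff G).2 fun x hx => hk' x (hd.subset_dcl C hx)⟩

end Rank


/-! ### From unbounded elements to elements that move every type maximally. -/

section Movers

variable {G : Type*} {M : Type*} [Group G] [MulAction G M] {d : Finset M → ℤ}

/-- Over every set `X ⊇ A` of finite dimension, every type has a realization `B` such that `B` and
`g • B` are as independent as possible over `X` and `g • X`. -/
def MovesMaximally (d : Finset M → ℤ) (g : G) (A : Set M) : Prop :=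
  ∀ X, FinDim d X → A ⊆ X → ∀ B, FinDim d B → X ⊆ B → ∃ a ∈ fixingSubgroup G X,
    rk d (X ∪ g • X) + 2 * rk d B ≤ rk d (a • B ∪ g • a • B) + 2 * rk d X

theorem MovesMaximally.mono {g : G} {A A' : Set M} (hg : MovesMaximally d g A) (h : A ⊆ A') :
    MovesMaximally d g A' := fun X hX hA => hg X hX (h.trans hA)

theorem smul_mem_fixingSubgroup {X : Set M} {a : G} (ha : a ∈ fixingSubgroup G X) (u : G) :
    u * a * u⁻¹ ∈ fixingSubgroup G (u • X) := by
  rw [mem_fixingSubgroup_iff] at ha ⊢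
  rintro _ ⟨x, hx, rfl⟩
  simp [mul_smul, ha x hx]

variable [DecidableEq M]

theorem MovesMaximally.conj (hd : IsDimensionFunction G d) {g : G} {A : Set M}
    (hg : MovesMaximally d g A) (u : G) : MovesMaximally d (u * g * u⁻¹) (u • A) := by
  intro X hX hA B hB hXB
  have hX' := hd.finDim_smul hX u⁻¹
  have hB' := hd.finDim_smul hB u⁻¹
  obtain ⟨a, ha, h⟩ := hg (u⁻¹ • X) hX' (Set.smul_set_subset_iff_subset_inv_smul_set.1 hA)
    (u⁻¹ • B) hB' (Set.smul_set_mono hXB)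
  refine ⟨u * a * u⁻¹, ?_, ?_⟩
  · simpa using smul_mem_fixingSubgroup ha u
  · rw [hd.rk_smul hX, hd.rk_smul hB,
      ← hd.rk_smul (hd.finDim_union hX' (hd.finDim_smul hX' g)) u,
      ← hd.rk_smul (hd.finDim_union (hd.finDim_smul hB' a)
        (hd.finDim_smul (hd.finDim_smul hB' a) g)) u] at h
    simpa [Set.smul_set_union, mul_smul] using h

/-- The pair formed by a set and its `g`-image is a pair for `g⁻¹` read in the opposite order. -/
theorem MovesMaximally.inv (hd : IsDimensionFunction G d) {g : G} {A : Set M}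
    (hg : MovesMaximally d g A) : MovesMaximally d g⁻¹ (g • A) := by
  intro X hX hA B hB hXB
  obtain ⟨a, ha, h⟩ := hg (g⁻¹ • X) (hd.finDim_smul hX _)
    (Set.smul_set_subset_iff_subset_inv_smul_set.1 hA)
    (g⁻¹ • B) (hd.finDim_smul hB _) (Set.smul_set_mono hXB)
  refine ⟨g * a * g⁻¹, ?_, ?_⟩
  · simpa using smul_mem_fixingSubgroup ha g
  · rw [hd.rk_smul hX, hd.rk_smul hB] at h
    simpa [mul_smul, Set.union_comm] using h

theorem IsUnboundedOver.exists_moved (hd : IsDimensionFunction G d) (hex : HasExistence G d)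
    {A₀ : Set M} {g : G} (hg : IsUnboundedOver d A₀ g) {X : Set M} (hX : FinDim d X)
    (hA₀ : A₀ ⊆ X) {b : M}
    (hb : ∀ f ∈ fixingSubgroup G X, ∀ C ∈ finClosures d, X ⊆ C → f • b ∉ C →
      IsBasic d C (f • b)) :
    ∃ a ∈ fixingSubgroup G X, rk d (X ∪ g • X) + 2 * rk d ({b} ∪ X) ≤
      rk d (a • ({b} ∪ X) ∪ g • a • ({b} ∪ X)) + 2 * rk d X := by
  have hgX := hd.finDim_smul hX g
  have hsing : ∀ x : M, FinDim d {x} := fun x => hd.finDim_finite (Set.finite_singleton x)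
  have hbX := hd.finDim_union (hsing b) hX
  by_cases hbcl : b ∈ dcl d X
  · rw [hd.mem_dcl_iff_rk hX] at hbcl
    refine ⟨1, one_mem _, ?_⟩
    rw [one_smul, hbcl]
    have := (hd.finDim_union hbX (hd.finDim_smul hbX g)).rk_mono
      (Set.union_subset_union (s₁ := X) Set.subset_union_right
        (Set.smul_set_mono (a := g) (s := X) Set.subset_union_right))
    linarith
  -- The translate by `g⁻¹` is included because the rank of g b' over X ∪ gX equals that of b' over
  -- X ∪ g⁻¹X, which must be as large as the rank of b over X.
  set Y := X ∪ g • X ∪ g⁻¹ • X with hYdef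
  have hY : FinDim d Y := hd.finDim_union (hd.finDim_union hX hgX) (hd.finDim_smul hX _)
  have hXY : X ⊆ Y := fun x hx => Or.inl (Or.inl hx)
  have hC := hd.dcl_mem hY
  set C := dcl d Y with hCdef
  have hYC : Y ⊆ C := hd.subset_dcl Y
  have hC' := hd.finDim_of_mem hC
  -- First `b` is moved over `X` to be independent from `Y`, hence outside `C` and basic over it;
  -- unboundedness over `C` then separates it from its `g`-image.
  obtain ⟨t, ht, htY⟩ := hd.exists_indep hex (hsing b) hX hY
  rw [Set.smul_set_singleton] at htY
  have hδ : rk d X < rk d ({b} ∪ X) :=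
    lt_of_le_of_ne (hbX.rk_mono Set.subset_union_right)
      (fun h => hbcl ((hd.mem_dcl_iff_rk hX).2 h.symm))
  rw [Set.union_eq_right.2 hXY, Set.union_assoc, Set.union_eq_right.2 hXY] at htY
  have htb : t • b ∉ C := by
    rw [hCdef, hd.mem_dcl_iff_rk hY]
    intro h
    rw [h] at htY
    linarith
  obtain ⟨_, ⟨s, rfl⟩, hs⟩ := hg C hC (hA₀.trans (hXY.trans hYC)) _
    (hb t ht C hC (hXY.trans hYC) htb)
  obtain ⟨s, hsC⟩ := s
  change Indep d {g • s • t • b} C {s • t • b} at hs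
  have hsX : s ∈ fixingSubgroup G X := fixingSubgroup_le (hXY.trans hYC) hsC
  have haX : s * t ∈ fixingSubgroup G X := mul_mem hsX ht
  refine ⟨s * t, haX, ?_⟩
  rw [Set.smul_set_union, smul_set_eq_of_fixing haX, Set.smul_set_singleton, mul_smul,
    Set.smul_set_union, Set.smul_set_singleton]
  have e₁ : rk d ({s • t • b} ∪ C) = rk d ({t • b} ∪ C) := by
    rw [← hd.rk_smul (hd.finDim_union (hsing (t • b)) hC') s, Set.smul_set_union,
      Set.smul_set_singleton, smul_set_eq_of_fixing hsC]
  have e₂ : rk d ({s • t • b} ∪ X) = rk d ({b} ∪ X) := by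
    rw [← hd.rk_smul (hd.finDim_union (hsing b) hX) (s * t), Set.smul_set_union,
      Set.smul_set_singleton, smul_set_eq_of_fixing haX, mul_smul]
  have e₃ : rk d ({t • b} ∪ C) = rk d ({t • b} ∪ Y) := hd.rk_union_dcl hY (hsing _)
  have e₄ : rk d C = rk d Y := hd.rk_dcl hY
  generalize s • t • b = b' at *
  have hb' := hsing b'
  have hgb' := hsing (g • b')
  rw [hd.indep_iff hgb' hC' hb', Set.union_comm C {b'}] at hs
  have hXg := hd.finDim_union hX hgX
  have i₁ := hd.rk_submodular (S := {b'} ∪ X ∪ ({g • b'} ∪ g • X)) (T := {g • b'} ∪ C)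
    (U := {g • b'} ∪ (X ∪ g • X))
    (hd.finDim_union (hd.finDim_union hb' hX) (hd.finDim_union hgb' hgX))
    (hd.finDim_union hgb' hC') (by intro x; simp; tauto)
    (Set.union_subset_union_right _ (fun x hx => hYC (Or.inl hx)))
  have i₂ : rk d ({g • b'} ∪ C ∪ {b'}) ≤ rk d ({b'} ∪ X ∪ ({g • b'} ∪ g • X) ∪ ({g • b'} ∪ C)) :=
    (hd.finDim_union (hd.finDim_union (hd.finDim_union hb' hX) (hd.finDim_union hgb' hgX))
      (hd.finDim_union hgb' hC')).rk_mono (by intro x; simp; tauto)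
  have hXg' := hd.finDim_union hX (hd.finDim_smul hX g⁻¹)
  have hsub : X ∪ g⁻¹ • X ⊆ C :=
    Set.Subset.trans (by rw [hYdef]; intro x; simp only [Set.mem_union]; tauto) hYC
  have i₃ := hd.rk_submodular (S := {b'} ∪ (X ∪ g⁻¹ • X)) (T := C) (U := X ∪ g⁻¹ • X)
    (hd.finDim_union hb' hXg') hC' Set.subset_union_right hsub
  rw [Set.union_assoc, Set.union_eq_right.2 hsub] at i₃
  have e₅ : rk d ({g • b'} ∪ (X ∪ g • X)) = rk d ({b'} ∪ (X ∪ g⁻¹ • X)) := by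
    rw [← hd.rk_smul (hd.finDim_union hb' hXg') g, Set.smul_set_union, Set.smul_set_union,
      Set.smul_set_singleton, smul_inv_smul, Set.union_comm X]
  have e₆ : rk d (X ∪ g • X) = rk d (X ∪ g⁻¹ • X) := by
    rw [← hd.rk_smul hXg' g, Set.smul_set_union, smul_inv_smul, Set.union_comm X]
  linarith

/-- Relative rank does not increase from `A` to `C`, so a drop below the rank over `C` is also a
drop below the rank over `A`. -/
theorem IsDimensionFunction.isBasic_mono (hd : IsDimensionFunction G d) {A C : Set M} {b : M}
    (hA : FinDim d A) (hC : C ∈ finClosures d) (hAC : A ⊆ C) (hb : IsBasic d A b) (hbC : b ∉ C) :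
    IsBasic d C b := by
  refine ⟨hbC, fun C' hC' hCC' h => hb.2 C' hC' (hAC.trans hCC') (h.trans_le ?_)⟩
  have hC₁ := hd.finDim_of_mem hC
  have hb₁ := hd.finDim_finset {b}
  rw [hd.relDim_eq _ hC₁, hd.relDim_eq _ hA]
  have := hd.rk_submodular (S := ↑({b} : Finset M) ∪ A) (T := C) (U := A)
    (hd.finDim_union hb₁ hA) hC₁ Set.subset_union_right hAC
  rw [Set.union_assoc, Set.union_eq_right.2 hAC] at this
  linarith

/-- The one-point step is iterated along a finite subset of `D`. An arbitrary `B` has its rank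
carried by finitely many points, each in the closure of X and finitely many elements of `D`; maximal
independence then descends to `B` from the larger set. -/
theorem IsUnboundedOver.movesMaximally (hd : IsDimensionFunction G d) (hex : HasExistence G d)
    {A D A₀ : Set M} (hA : FinDim d A)
    (hD_inv : ∀ f ∈ fixingSubgroup G A, ∀ x ∈ D, f • x ∈ D)
    (hD_basic : ∀ x ∈ D \ A, IsBasic d A x) (hD_cl : dcl d (D ∪ A) = Set.univ)
    {g : G} (hg : IsUnboundedOver d A₀ g) : MovesMaximally d g (A ∪ A₀) := by
  intro X hX hAX B hB hXB
  have hA' : A ⊆ X := Set.subset_union_left.trans hAX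
  have hA₀' : A₀ ⊆ X := Set.subset_union_right.trans hAX
  have hgX := hd.finDim_smul hX g
  -- finite subsets of `D`
  have key : ∀ E : Finset M, (E : Set M) ⊆ D → ∃ a ∈ fixingSubgroup G X,
      rk d (X ∪ g • X) + 2 * rk d (↑E ∪ X) ≤
        rk d (a • (↑E ∪ X) ∪ g • a • (↑E ∪ X)) + 2 * rk d X := by
    intro E hE
    induction E using Finset.induction_on with
    | empty => exact ⟨1, one_mem _, by simp⟩
    | insert e E _ ih =>
      rw [Finset.coe_insert, Set.insert_subset_iff] at hE
      obtain ⟨a, ha, h⟩ := ih hE.2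
      have hEX := hd.finDim_union (hd.finDim_finset E) hX
      have hX' := hd.finDim_smul hEX a
      have hXX' : X ⊆ a • (↑E ∪ X) := by
        rw [Set.smul_set_union, smul_set_eq_of_fixing ha]
        exact Set.subset_union_right
      -- The part already moved becomes the new base, so `a'` leaves it in place and the two rank
      -- inequalities telescope.
      obtain ⟨a', ha', h'⟩ := hg.exists_moved hd hex (b := a • e) hX' (hA₀'.trans hXX') (by
        intro f hf C hC hXC hfC
        refine hd.isBasic_mono hA hC (hA'.trans (hXX'.trans hXC)) (hD_basic _ ⟨?_, ?_⟩) hfC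
        · exact hD_inv f (fixingSubgroup_le (hA'.trans hXX') hf) _
            (hD_inv a (fixingSubgroup_le hA' ha) _ hE.1)
        · exact fun h => hfC (hXC (hXX' (hA' h))))
      refine ⟨a' * a, mul_mem (fixingSubgroup_le hXX' ha') ha, ?_⟩
      have e' : a' • ({a • e} ∪ a • (↑E ∪ X)) = (a' * a) • (↑(insert e E) ∪ X) := by
        rw [mul_smul, Finset.coe_insert, ← Set.smul_set_singleton, ← Set.smul_set_union,
          Set.insert_eq, Set.union_assoc]
      have e'' : rk d ({a • e} ∪ a • (↑E ∪ X)) = rk d (↑(insert e E) ∪ X) := by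
        rw [← hd.rk_smul (hd.finDim_union (hd.finDim_finset (insert e E)) hX) a,
          Finset.coe_insert, ← Set.smul_set_singleton, ← Set.smul_set_union,
          Set.insert_eq, Set.union_assoc]
      rw [e', e'', hd.rk_smul hEX] at h'
      linarith
  -- `B` lies in the closure of `X` and a finite subset of `D`
  obtain ⟨F, hFB, hF⟩ := hB.exists_rk
  have hcl : ∀ x : M, ∃ E : Finset M, (E : Set M) ⊆ D ∧ x ∈ dcl d (↑E ∪ X) := by
    intro x
    have hx : x ∈ dcl d (D ∪ A) := hD_cl ▸ Set.mem_univ x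
    obtain ⟨Y, hY, e⟩ := hd.mem_dcl_iff.1 hx
    obtain ⟨Y₁, Y₂, h₁, h₂, rfl⟩ := exists_finset_split hY
    refine ⟨Y₁, h₁, hd.mem_dcl_iff.2 ⟨_, ?_, e⟩⟩
    rw [Finset.coe_union]
    exact Set.union_subset_union_right _ (h₂.trans hA')
  choose E hED hE using hcl
  obtain ⟨a, ha, h⟩ := key (F.biUnion E) (by
    intro x hx
    simp only [Finset.coe_biUnion, Set.mem_iUnion] at hx
    obtain ⟨i, _, hi⟩ := hx
    exact hED i hi)
  refine ⟨a, ha, ?_⟩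
  set S : Set M := ↑(F.biUnion E) ∪ X with hS
  have hS' : FinDim d S := hd.finDim_union (hd.finDim_finset _) hX
  have hFS : (F : Set M) ⊆ dcl d S := fun x hx =>
    hd.dcl_mono (Set.union_subset_union_left _ (by
      exact_mod_cast Finset.subset_biUnion_of_mem E hx)) (hE x)
  have hBS : rk d (B ∪ S) = rk d S := by
    rw [hd.rk_union_eq hB hS' hFB (by rw [hd.rk_finset, hF])]
    exact hd.rk_union_of_subset_dcl hS' F hFS
  have hBSf := hd.finDim_union hB hS'
  -- monotonicity of independence
  have haB := hd.finDim_smul hB a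
  have hgaB := hd.finDim_smul haB g
  have haT := hd.finDim_smul hBSf a
  have hgaT := hd.finDim_smul haT g
  have hm : rk d (a • S ∪ g • a • S) ≤ rk d (a • (B ∪ S) ∪ g • a • (B ∪ S)) :=
    (hd.finDim_union haT hgaT).rk_mono (Set.union_subset_union
      (Set.smul_set_mono Set.subset_union_right)
      (Set.smul_set_mono (Set.smul_set_mono Set.subset_union_right)))
  have i₁ := hd.rk_submodular (S := a • (B ∪ S)) (T := a • B ∪ g • a • B) (U := a • B)
    haT (hd.finDim_union haB hgaB) (Set.smul_set_mono Set.subset_union_left)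
    Set.subset_union_left
  have i₂ := hd.rk_submodular (S := g • a • (B ∪ S)) (T := a • (B ∪ S) ∪ (a • B ∪ g • a • B))
    (U := g • a • B) hgaT (hd.finDim_union haT (hd.finDim_union haB hgaB))
    (Set.smul_set_mono (Set.smul_set_mono Set.subset_union_left))
    (by intro x; simp only [Set.mem_union]; tauto)
  have i₃ : rk d (a • (B ∪ S) ∪ g • a • (B ∪ S)) ≤
      rk d (g • a • (B ∪ S) ∪ (a • (B ∪ S) ∪ (a • B ∪ g • a • B))) :=
    (hd.finDim_union hgaT (hd.finDim_union haT (hd.finDim_union haB hgaB))).rk_mono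
      (by intro x; simp only [Set.mem_union]; tauto)
  rw [hd.rk_smul haT, hd.rk_smul haB] at i₂
  rw [hd.rk_smul hBSf, hd.rk_smul hB] at i₁ i₂
  linarith

end Movers


/-! ### Prescribing the values of products of conjugates on sets of finite dimension. -/

section Density

variable {G : Type*} {M : Type*} [Group G] [MulAction G M] {d : Finset M → ℤ}

theorem smul_set_congr {X : Set M} {a b : G} (h : ∀ x ∈ X, a • x = b • x) : a • X = b • X :=
  Set.image_congr h

theorem conj_smul_of_fixing {X : Set M} {a g : G} (ha : a ∈ fixingSubgroup G (X ∪ g • X))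
    {x : M} (hx : x ∈ X) : (a * g * a⁻¹) • x = g • x := by
  have ha' := inv_mem ha
  rw [mem_fixingSubgroup_iff] at ha ha'
  rw [mul_smul, ha' x (Or.inl hx), mul_smul, ha _ (Or.inr (Set.smul_mem_smul_set hx))]

variable [DecidableEq M]

/-- A type over `X` can be sent by a conjugate of `g` to any sufficiently independent type over
`g • X` which corresponds to it. -/
theorem MovesMaximally.exists_conj_eq (hd : IsDimensionFunction G d) (hst : IsStationary G d)
    {g : G} {A : Set M} (hg : MovesMaximally d g A) {X P : Set M} {r : G}
    (hX : X ∈ finClosures d) (hA : A ⊆ X ∪ g • X) (hXP : X ⊆ P) (hP : FinDim d P)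
    (hr : ∀ x ∈ X, r • x = g • x)
    (hind : rk d (X ∪ g • X) + 2 * rk d P ≤ rk d (P ∪ r • P) + 2 * rk d X) :
    ∃ a ∈ fixingSubgroup G (X ∪ g • X), ∀ x ∈ P, (a * g * a⁻¹) • x = r • x := by
  have hX' := hd.finDim_of_mem hX
  have hgX := hd.finDim_smul hX' g
  have hZ := hd.finDim_union hX' hgX
  have hB := hd.finDim_union hP hgX
  have hYQ : g • X ⊆ r • P := by
    rw [← smul_set_congr hr]
    exact Set.smul_set_mono hXP
  have hQ := hd.finDim_smul hP r
  have eB : P ∪ (X ∪ g • X) = P ∪ g • X := by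
    rw [← Set.union_assoc, Set.union_eq_left.2 hXP]
  obtain ⟨t, ht, h⟩ := hg (X ∪ g • X) hZ hA (P ∪ g • X) hB
    (eB ▸ Set.subset_union_right)
  have htX : t ∈ fixingSubgroup G X := fixingSubgroup_le Set.subset_union_left ht
  have htY : t ∈ fixingSubgroup G (g • X) := fixingSubgroup_le Set.subset_union_right ht
  set B := P ∪ g • X with hBdef
  have htB := hd.finDim_smul hB t
  have hgtB := hd.finDim_smul htB g
  have hYtB : g • X ⊆ t • B := by
    rw [← smul_set_eq_of_fixing htY]
    exact Set.smul_set_mono Set.subset_union_right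
  have hXtB : X ⊆ t • B := by
    rw [← smul_set_eq_of_fixing htX]
    exact Set.smul_set_mono (hXP.trans Set.subset_union_left)
  have eY := hd.rk_smul hX' g
  have eQ := hd.rk_smul hP r
  -- upper and lower bounds for `rk d B`
  have b₁ := hd.rk_submodular hP hZ (U := X) hXP Set.subset_union_left
  rw [eB] at b₁
  have b₂ := hd.rk_submodular hB hQ (U := g • X) Set.subset_union_right hYQ
  rw [show B ∪ r • P = P ∪ r • P by
    rw [hBdef, Set.union_assoc, Set.union_eq_right.2 hYQ]] at b₂
  -- `k₀` carries t r P to g t P and fixes gX pointwise. Both sets are independent from tB over gX,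
  -- so stationarity replaces `k₀` by some `k` that fixes tB pointwise; conjugating `g` by (kt)⁻¹
  -- then gives `r` on `P`.
  set k₀ := g * t * r⁻¹ * t⁻¹ with hk₀
  have hgtP : k₀ • t • r • P = g • t • P := by simp [hk₀, mul_smul]
  obtain ⟨k, hk, hkB⟩ := hd.exists_extension hst (A := t • r • P) (B := g • X) (C := t • B)
    (hd.finDim_smul hQ t) (hd.smul_mem g hX) htB
    (by rw [← smul_set_eq_of_fixing htY]; exact Set.smul_set_mono hYQ) k₀
    (by
      have ht' := inv_mem ht
      rw [mem_fixingSubgroup_iff] at ht ht' ⊢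
      rintro _ ⟨x, hx, rfl⟩
      change k₀ • g • x = g • x
      rw [hk₀, mul_smul, ht' _ (Or.inr (Set.smul_mem_smul_set hx)), mul_smul, ← hr x hx,
        inv_smul_smul, mul_smul, ht x (Or.inl hx), hr x hx])
    (by
      rw [Set.union_eq_right.2 hYtB, ← Set.smul_set_union, hd.rk_smul hQ, hd.rk_smul hB,
        hd.rk_smul (hd.finDim_union hQ hB), eQ, eY]
      have e : r • P ∪ B = P ∪ r • P := by
        rw [hBdef, Set.union_comm, Set.union_assoc, Set.union_eq_right.2 hYQ]
      rw [e]
      linarith)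
    (by
      have htP := hd.finDim_smul hP t
      have hgtP' := hd.finDim_smul htP g
      rw [Set.union_eq_right.2 hYtB, hgtP, hd.rk_smul hQ, hd.rk_smul hB, eQ, eY]
      have i := hd.rk_submodular (S := g • t • P ∪ t • B)
        (T := (X ∪ g • X) ∪ g • (X ∪ g • X)) (U := X ∪ g • X) (hd.finDim_union hgtP' htB)
        (hd.finDim_union hZ (hd.finDim_smul hZ g))
        ((Set.union_subset hXtB hYtB).trans Set.subset_union_right) Set.subset_union_left
      have j : rk d (t • B ∪ g • t • B) ≤
          rk d (g • t • P ∪ t • B ∪ ((X ∪ g • X) ∪ g • (X ∪ g • X))) := by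
        apply (hd.finDim_union (hd.finDim_union hgtP' htB)
          (hd.finDim_union hZ (hd.finDim_smul hZ g))).rk_mono
        have e : t • B = t • P ∪ g • X := by
          rw [hBdef, Set.smul_set_union, smul_set_eq_of_fixing htY]
        rw [e]
        simp only [Set.smul_set_union]
        intro x
        simp only [Set.mem_union]
        tauto
      linarith)
  refine ⟨(k * t)⁻¹, inv_mem (mul_mem (fixingSubgroup_le (Set.union_subset hXtB hYtB) hkB) ht),
    fun x hx => ?_⟩
  have e₁ : k • t • x = t • x :=
    (mem_fixingSubgroup_iff G).1 hkB _ (Set.smul_mem_smul_set (Or.inl hx))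
  have e₂ : k • t • r • x = g • t • x := by
    rw [hk _ (Set.smul_mem_smul_set (Set.smul_mem_smul_set hx))]
    simp [hk₀, mul_smul]
  rw [inv_inv, mul_smul, mul_smul, mul_smul k, e₁, ← e₂, ← mul_smul k, inv_smul_smul]

/-- Put Z = X ∪ gX. Maximal movement makes the relative rank of `Y` over the image of `P` at least
its relative rank over Z, and `hind` makes the latter at least its relative rank over gX. -/
theorem MovesMaximally.exists_conj_indep (hd : IsDimensionFunction G d)
    {g : G} {A : Set M} (hg : MovesMaximally d g A) {X Y P : Set M}
    (hX : FinDim d X) (hA : A ⊆ X ∪ g • X) (hP : FinDim d P) (hXP : X ∪ g • X ⊆ P) (hYP : Y ⊆ P)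
    (hind : rk d (X ∪ g • X) + rk d (g • X ∪ Y) ≤ rk d (X ∪ g • X ∪ Y) + rk d (g • X)) :
    ∃ a ∈ fixingSubgroup G (X ∪ g • X), rk d ((a * g * a⁻¹) • P) + rk d (g • X ∪ Y) ≤
      rk d ((a * g * a⁻¹) • P ∪ Y) + rk d (g • X) := by
  have hZ := hd.finDim_union hX (hd.finDim_smul hX g)
  obtain ⟨t, ht, h⟩ := hg (X ∪ g • X) hZ hA P hP hXP
  generalize X ∪ g • X = Z at *
  have hgZ := hd.finDim_smul hZ g
  have htP := hd.finDim_smul hP t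
  have ht' := inv_mem ht
  refine ⟨t⁻¹, ht', ?_⟩
  rw [inv_inv, hd.rk_smul hP]
  have e₁ : rk d (t • P ∪ g • t • P) = rk d (P ∪ (t⁻¹ * g * t) • P) := by
    rw [← hd.rk_smul (hd.finDim_union htP (hd.finDim_smul htP g)) t⁻¹, Set.smul_set_union,
      inv_smul_smul, mul_smul, mul_smul]
  have e₂ : (t⁻¹ * g * t) • Z = t⁻¹ • g • Z := by
    rw [mul_smul, smul_set_eq_of_fixing ht, mul_smul]
  have e₃ : rk d (t⁻¹ • g • Z ∪ Z) = rk d (Z ∪ g • Z) := by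
    rw [← hd.rk_smul (hd.finDim_union hZ hgZ) t⁻¹, Set.smul_set_union, Set.union_comm,
      smul_set_eq_of_fixing ht']
  have hP₁ := hd.finDim_smul hP (t⁻¹ * g * t)
  have hZP₁ : t⁻¹ • g • Z ⊆ (t⁻¹ * g * t) • P := e₂ ▸ Set.smul_set_mono hXP
  set P₁ := (t⁻¹ * g * t) • P with hP₁def
  have htgZ := hd.finDim_smul hgZ t⁻¹
  have hY := hP.mono hYP
  have hP₁Y := hd.finDim_union hP₁ hY
  have i₁ := hd.rk_submodular (S := P) (T := P₁ ∪ Y ∪ Z) (U := Z ∪ Y) hP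
    (hd.finDim_union hP₁Y hZ) (Set.union_subset hXP hYP)
    (by intro x; simp only [Set.mem_union]; tauto)
  have j₁ : rk d (P ∪ P₁) ≤ rk d (P ∪ (P₁ ∪ Y ∪ Z)) :=
    (hd.finDim_union hP (hd.finDim_union hP₁Y hZ)).rk_mono
      (by intro x; simp only [Set.mem_union]; tauto)
  have i₂ := hd.rk_submodular (S := P₁ ∪ Y) (T := t⁻¹ • g • Z ∪ Z) (U := t⁻¹ • g • Z) hP₁Y
    (hd.finDim_union htgZ hZ) (hZP₁.trans Set.subset_union_left) Set.subset_union_left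
  have j₂ : rk d (P₁ ∪ Y ∪ Z) ≤ rk d (P₁ ∪ Y ∪ (t⁻¹ • g • Z ∪ Z)) :=
    (hd.finDim_union hP₁Y (hd.finDim_union htgZ hZ)).rk_mono
      (by intro x; simp only [Set.mem_union]; tauto)
  rw [hd.rk_smul hgZ, hd.rk_smul hZ] at i₂
  linarith

/-- The map `r` is factored through a copy of g₂P chosen over `Y₂` independently from P ∪ rP. By
`h₁` and `h₃` this copy is in general position to both `P` and `r • P`, so each half is induced by a
single conjugate. -/
theorem exists_conj_mul_conj_eq (hd : IsDimensionFunction G d) (hex : HasExistence G d)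
    (hst : IsStationary G d) {g₂ g₃ : G} {A₂ A₃ : Set M} (hg₂ : MovesMaximally d g₂ A₂)
    (hg₃ : MovesMaximally d g₃ A₃) {Y₁ Y₂ Y₃ P : Set M} {r : G}
    (hY₁ : Y₁ ∈ finClosures d) (e₂ : g₂ • Y₁ = Y₂) (e₃ : g₃ • Y₂ = Y₃)
    (hA₂ : A₂ ⊆ Y₁ ∪ Y₂) (hA₃ : A₃ ⊆ Y₂ ∪ Y₃) (hYP : Y₁ ⊆ P) (hP : FinDim d P)
    (hr : ∀ x ∈ Y₁, r • x = g₃ • g₂ • x)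
    (h₁ : rk d P + rk d (Y₁ ∪ Y₂) ≤ rk d (P ∪ Y₂) + rk d Y₁)
    (h₃ : rk d (r • P) + rk d (Y₃ ∪ Y₂) ≤ rk d (r • P ∪ Y₂) + rk d Y₃) :
    ∃ a₂ ∈ fixingSubgroup G (Y₁ ∪ Y₂), ∃ a₃ ∈ fixingSubgroup G (Y₂ ∪ Y₃),
      ∀ x ∈ P, (a₃ * g₃ * a₃⁻¹) • (a₂ * g₂ * a₂⁻¹) • x = r • x := by
  have hY₂ := e₂ ▸ hd.smul_mem g₂ hY₁
  have hY₁' := hd.finDim_of_mem hY₁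
  have hY₂' := hd.finDim_of_mem hY₂
  have hQ := hd.finDim_smul hP r
  have hC := hd.finDim_union hP hQ
  have hg₂P := hd.finDim_smul hP g₂
  obtain ⟨s, hs, h⟩ := hd.exists_indep hex hg₂P hY₂' hC
  have hs' := inv_mem hs
  have hYg : Y₂ ⊆ g₂ • P := e₂ ▸ Set.smul_set_mono hYP
  have hP₂ := hd.finDim_smul hg₂P s
  have hYP₂ : Y₂ ⊆ s • g₂ • P := by
    rw [← smul_set_eq_of_fixing hs]
    exact Set.smul_set_mono hYg
  have ek₂ : rk d (s • g₂ • P) = rk d P := by rw [hd.rk_smul hg₂P, hd.rk_smul hP]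
  rw [Set.union_eq_left.2 hYg, hd.rk_smul hP, Set.union_eq_left.2 hYP₂] at h
  have ek : rk d Y₂ = rk d Y₁ := by rw [← e₂, hd.rk_smul hY₁']
  have ek' : rk d Y₃ = rk d Y₂ := by rw [← e₃, hd.rk_smul hY₂']
  have eQ := hd.rk_smul hP r
  have side : ∀ R, FinDim d R → R ⊆ P ∪ r • P →
      rk d P + rk d (R ∪ Y₂) ≤ rk d (s • g₂ • P ∪ R) + rk d Y₂ := by
    intro R hR hRC
    have i := hd.rk_submodular (S := s • g₂ • P ∪ R) (T := Y₂ ∪ (P ∪ r • P)) (U := R ∪ Y₂)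
      (hd.finDim_union hP₂ hR) (hd.finDim_union hY₂' hC)
      (Set.union_subset Set.subset_union_right (hYP₂.trans Set.subset_union_left))
      (Set.union_subset (hRC.trans Set.subset_union_right) Set.subset_union_left)
    have j : rk d (s • g₂ • P ∪ (P ∪ r • P)) ≤ rk d (s • g₂ • P ∪ R ∪ (Y₂ ∪ (P ∪ r • P))) :=
      (hd.finDim_union (hd.finDim_union hP₂ hR) (hd.finDim_union hY₂' hC)).rk_mono
        (by intro x; simp only [Set.mem_union]; tauto)
    linarith
  have s₁ := side P hP Set.subset_union_left
  have s₃ := side (r • P) hQ Set.subset_union_right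
  rw [Set.union_comm] at s₁
  rw [mem_fixingSubgroup_iff] at hs hs'
  obtain ⟨a₂, ha₂, ha₂'⟩ := hg₂.exists_conj_eq hd hst (r := s * g₂) hY₁ (e₂ ▸ hA₂) hYP hP
    (fun x hx => by rw [mul_smul, hs _ (e₂ ▸ Set.smul_mem_smul_set hx)])
    (by
      rw [e₂, mul_smul, Set.union_comm P]
      rw [Set.union_comm] at s₁
      linarith)
  obtain ⟨a₃, ha₃, ha₃'⟩ := hg₃.exists_conj_eq hd hst (r := r * (s * g₂)⁻¹) (P := s • g₂ • P)
    hY₂ (e₃ ▸ hA₃) hYP₂ hP₂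
    (by
      intro x hx
      have hx' := hx
      rw [← e₂] at hx'
      obtain ⟨y, hy, rfl⟩ := hx'
      change g₂ • y ∈ Y₂ at hx
      change (r * (s * g₂)⁻¹) • g₂ • y = g₃ • g₂ • y
      rw [← hr y hy, mul_inv_rev, mul_smul, mul_smul, hs' _ hx, inv_smul_smul])
    (by
      have e : (r * (s * g₂)⁻¹) • s • g₂ • P = r • P := by simp [mul_smul]
      rw [e, e₃, ek₂, Set.union_comm Y₂]
      linarith)
  refine ⟨a₂, e₂ ▸ ha₂, a₃, e₃ ▸ ha₃, fun x hx => ?_⟩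
  rw [ha₂' x hx, mul_smul s, ha₃' _ (Set.smul_mem_smul_set (Set.smul_mem_smul_set hx))]
  simp [mul_smul]

/-- Conjugates of `g₁` and `g₄⁻¹` push a large source and its `r`-image to sets independent from
`Y₂` over `Y₁` and `Y₃`. The two middle conjugates then join these images. -/
theorem exists_conj_prod_eq (hd : IsDimensionFunction G d) (hex : HasExistence G d)
    (hst : IsStationary G d) {g₁ g₂ g₃ g₄ : G} {A : Set M}
    (hg₁ : MovesMaximally d g₁ A) (hg₂ : MovesMaximally d g₂ A) (hg₃ : MovesMaximally d g₃ A)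
    (hg₄ : MovesMaximally d g₄⁻¹ A) {Y₀ Y₁ Y₂ Y₃ Y₄ : Set M} (hY₀ : Y₀ ∈ finClosures d)
    (e₁ : g₁ • Y₀ = Y₁) (e₂ : g₂ • Y₁ = Y₂) (e₃ : g₃ • Y₂ = Y₃) (e₄ : g₄ • Y₃ = Y₄)
    (hA₁ : A ⊆ Y₁) (hA₃ : A ⊆ Y₃)
    (h₁ : rk d (Y₀ ∪ Y₁) + rk d (Y₁ ∪ Y₂) ≤ rk d (Y₀ ∪ Y₁ ∪ Y₂) + rk d Y₁)
    (h₃ : rk d (Y₄ ∪ Y₃) + rk d (Y₃ ∪ Y₂) ≤ rk d (Y₄ ∪ Y₃ ∪ Y₂) + rk d Y₃) {r : G}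
    (hr : ∀ x ∈ Y₀, r • x = (g₄ * g₃ * g₂ * g₁) • x) {B : Set M} (hB : FinDim d B) :
    ∃ a₁ ∈ fixingSubgroup G Y₁, ∃ a₂ ∈ fixingSubgroup G Y₁, ∃ a₃ ∈ fixingSubgroup G Y₃,
      ∃ a₄ ∈ fixingSubgroup G Y₃, ∀ x ∈ B,
        ((a₄ * g₄ * a₄⁻¹) * (a₃ * g₃ * a₃⁻¹) * (a₂ * g₂ * a₂⁻¹) * (a₁ * g₁ * a₁⁻¹)) • x =
          r • x := by
  have hY₁ := e₁ ▸ hd.smul_mem g₁ hY₀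
  have hY₂ := e₂ ▸ hd.smul_mem g₂ hY₁
  have hY₃ := e₃ ▸ hd.smul_mem g₃ hY₂
  have hY₄ := e₄ ▸ hd.smul_mem g₄ hY₃
  have e₄' : g₄⁻¹ • Y₄ = Y₃ := by rw [← e₄, inv_smul_smul]
  have f₀ := hd.finDim_of_mem hY₀
  have f₁ := hd.finDim_of_mem hY₁
  have f₂ := hd.finDim_of_mem hY₂
  have f₃ := hd.finDim_of_mem hY₃
  have f₄ := hd.finDim_of_mem hY₄
  -- Chosen so that `P` contains Y₀, Y₁, Y₂ and `r • P` contains Y₂, Y₃, Y₄, as needed for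
  -- separating both ends from `Y₂`.
  set P := B ∪ (Y₀ ∪ Y₁) ∪ Y₂ ∪ r⁻¹ • (Y₄ ∪ Y₃ ∪ Y₂) with hPdef
  have hP : FinDim d P := hd.finDim_union (hd.finDim_union (hd.finDim_union hB
    (hd.finDim_union f₀ f₁)) f₂) (hd.finDim_smul (hd.finDim_union (hd.finDim_union f₄ f₃) f₂) _)
  have hBP : B ⊆ P := by rw [hPdef]; intro x; simp only [Set.mem_union]; tauto
  have hYP : Y₀ ∪ Y₁ ⊆ P := by rw [hPdef]; intro x; simp only [Set.mem_union]; tauto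
  have hYP₂ : Y₂ ⊆ P := by rw [hPdef]; intro x; simp only [Set.mem_union]; tauto
  have hQ : Y₄ ∪ Y₃ ∪ Y₂ ⊆ r • P := by
    rw [Set.subset_smul_set_iff]
    exact Set.subset_union_right
  obtain ⟨a₁, ha₁, i₁⟩ := hg₁.exists_conj_indep hd (Y := Y₂) f₀
    (by rw [e₁]; exact hA₁.trans Set.subset_union_right) hP (e₁ ▸ hYP) hYP₂ (by rwa [e₁])
  obtain ⟨a₄, ha₄, i₄⟩ := hg₄.exists_conj_indep hd (Y := Y₂) f₄
    (by rw [e₄']; exact hA₃.trans Set.subset_union_right) (hd.finDim_smul hP r)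
    (by rw [e₄']; exact Set.subset_union_left.trans hQ) (Set.subset_union_right.trans hQ)
    (by rwa [e₄'])
  have c₁ : ∀ x ∈ Y₀, (a₁ * g₁ * a₁⁻¹) • x = g₁ • x := fun x hx => conj_smul_of_fixing ha₁ hx
  have c₄ : ∀ x ∈ Y₄, (a₄ * g₄⁻¹ * a₄⁻¹) • x = g₄⁻¹ • x := fun x hx => conj_smul_of_fixing ha₄ hx
  rw [e₁] at i₁ ha₁
  rw [e₄'] at i₄ ha₄
  have m₁ : Y₁ ⊆ (a₁ * g₁ * a₁⁻¹) • P := by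
    rw [← e₁, ← smul_set_congr c₁]
    exact Set.smul_set_mono (Set.subset_union_left.trans hYP)
  set p := a₁ * g₁ * a₁⁻¹ with hp
  set q := a₄ * g₄⁻¹ * a₄⁻¹ with hq
  have hqinv : a₄ * g₄ * a₄⁻¹ = q⁻¹ := by simp [hq, mul_assoc]
  obtain ⟨a₂, ha₂, a₃, ha₃, h⟩ := exists_conj_mul_conj_eq hd hex hst hg₂ hg₃
    (r := q * r * p⁻¹) hY₁ e₂ e₃ (hA₁.trans Set.subset_union_left)
    (hA₃.trans Set.subset_union_right) m₁ (hd.finDim_smul hP p)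
    (by
      intro x hx
      rw [← e₁] at hx
      obtain ⟨y, hy, rfl⟩ := hx
      change (q * r * p⁻¹) • g₁ • y = g₃ • g₂ • g₁ • y
      rw [mul_smul, ← c₁ y hy, inv_smul_smul, mul_smul, c₁ y hy, hr y hy, c₄]
      · simp [mul_smul]
      · rw [← e₄, ← e₃, ← e₂, ← e₁]
        simp only [mul_smul]
        exact Set.smul_mem_smul_set (Set.smul_mem_smul_set (Set.smul_mem_smul_set
          (Set.smul_mem_smul_set hy))))
    i₁
    (by
      rw [mul_smul (q * r), inv_smul_smul, mul_smul]
      exact i₄)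
  refine ⟨a₁, fixingSubgroup_le Set.subset_union_right ha₁,
    a₂, fixingSubgroup_le Set.subset_union_left ha₂,
    a₃, fixingSubgroup_le Set.subset_union_right ha₃,
    a₄, fixingSubgroup_le Set.subset_union_right ha₄, fun x hx => ?_⟩
  have := h (p • x) (Set.smul_mem_smul_set (hBP hx))
  rw [hqinv, mul_smul, mul_smul, mul_smul, this]
  simp [mul_smul]

end Density


/-! ### A back-and-forth solving P u = Q v for locally dense maps. -/

section Alternation

variable {ι G M : Type*} [Group G] [MulAction G M] {d : Finset M → ℤ}

/-- All members of the family `a` fix `X` pointwise. -/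
def FamilyFixes (X : Set M) (a : ι → G) : Prop := ∀ i, a i ∈ fixingSubgroup G X

theorem FamilyFixes.mono {X Y : Set M} {a : ι → G} (ha : FamilyFixes Y a) (h : X ⊆ Y) :
    FamilyFixes X a := fun i => fixingSubgroup_le h (ha i)

theorem FamilyFixes.smul_eq {X : Set M} {a : ι → G} (ha : FamilyFixes X a) (i : ι) {x : M}
    (hx : x ∈ X) : a i • x = x := (mem_fixingSubgroup_iff G).1 (ha i) x hx

theorem FamilyFixes.inv_smul_eq {X : Set M} {a : ι → G} (ha : FamilyFixes X a) (i : ι) {x : M}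
    (hx : x ∈ X) : (a i)⁻¹ • x = x := (mem_fixingSubgroup_iff G).1 (inv_mem (ha i)) x hx

/-- The values of `P` near `u` approximate every element which agrees with `P u` on `Y`. -/
def DenseAt (d : Finset M → ℤ) (P : (ι → G) → G) (X Y : Set M) (u : ι → G) : Prop :=
  ∀ r : G, (∀ x ∈ Y, r • x = P u • x) → ∀ B, FinDim d B →
    ∃ b, FamilyFixes X b ∧ ∀ x ∈ B, P (b * u) • x = r • x

/-- A continuous map such that the image of every nonempty open set is somewhere dense. -/
structure SomewhereDense (d : Finset M → ℤ) (P : (ι → G) → G) : Prop where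
  dense : ∀ u X, FinDim d X → ∃ a, FamilyFixes X a ∧ ∃ Y, FinDim d Y ∧ DenseAt d P X Y (a * u)
  locallyConst : ∀ u B, FinDim d B → ∃ X, FinDim d X ∧
    ∀ a, FamilyFixes X a → ∀ x ∈ B, P (a * u) • x = P u • x
  tendsto : ∀ (u : ℕ → ι → G) (v : ι → G), (∀ i (x : M), ∀ᶠ n in atTop, u n i • x = v i • x) →
    ∀ x : M, ∀ᶠ n in atTop, P (u n) • x = P v • x

theorem DenseAt.mono {P : (ι → G) → G} {X Y Y' : Set M} {u : ι → G} (h : DenseAt d P X Y u)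
    (hY : Y ⊆ Y') : DenseAt d P X Y' u := fun r hr B hB => h r (fun x hx => hr x (hY hx)) B hB

theorem eventually_mul_smul {u v : ℕ → G} {a b : G} (hu : ∀ x : M, ∀ᶠ n in atTop, u n • x = a • x)
    (hv : ∀ x : M, ∀ᶠ n in atTop, v n • x = b • x) (x : M) :
    ∀ᶠ n in atTop, (u n * v n) • x = (a * b) • x := by
  filter_upwards [hu (b • x), hv x] with n h₁ h₂
  rw [mul_smul, h₂, h₁, mul_smul]

theorem eventually_inv_smul {u : ℕ → G} {a : G} (hu : ∀ x : M, ∀ᶠ n in atTop, u n • x = a • x)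
    (x : M) : ∀ᶠ n in atTop, (u n)⁻¹ • x = a⁻¹ • x := by
  filter_upwards [hu (a⁻¹ • x)] with n h
  rw [inv_smul_eq_iff, h, smul_inv_smul]

/-- `G` is closed in the group of permutations of `M`. -/
def IsClosedAction (G M : Type*) [Group G] [MulAction G M] : Prop :=
  ∀ u : ℕ → G, (∀ x : M, ∃ y, ∀ᶠ n in atTop, u n • x = y) →
    (∀ x : M, ∃ y, ∀ᶠ n in atTop, (u n)⁻¹ • x = y) →
    ∃ g : G, ∀ x : M, ∀ᶠ n in atTop, u n • x = g • x

/-- The inverses have to stabilize as well, since a pointwise limit of permutations need not be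
surjective. -/
theorem IsClosedAction.exists_limit (hG : IsClosedAction G M) {T : ℕ → Set M}
    (hT : Monotone T) (hTu : ∀ x, ∃ n, x ∈ T n) (u : ℕ → G)
    (h : ∀ n, ∀ x ∈ T n, u (n + 1) • x = u n • x ∧ (u (n + 1))⁻¹ • x = (u n)⁻¹ • x) :
    ∃ g : G, ∀ x : M, ∀ᶠ n in atTop, u n • x = g • x := by
  have key : ∀ x N, x ∈ T N → ∀ n, N ≤ n → u n • x = u N • x ∧ (u n)⁻¹ • x = (u N)⁻¹ • x := by
    intro x N hx n hn
    induction n, hn using Nat.le_induction with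
    | base => exact ⟨rfl, rfl⟩
    | succ n hn ih =>
      have := h n x (hT hn hx)
      exact ⟨this.1.trans ih.1, this.2.trans ih.2⟩
  refine hG u (fun x => ?_) (fun x => ?_)
  · obtain ⟨N, hN⟩ := hTu x
    exact ⟨_, eventually_atTop.2 ⟨N, fun n hn => (key x N hN n hn).1⟩⟩
  · obtain ⟨N, hN⟩ := hTu x
    exact ⟨_, eventually_atTop.2 ⟨N, fun n hn => (key x N hN n hn).2⟩⟩

variable [DecidableEq M]

theorem IsDimensionFunction.finDim_iUnion [Finite ι] (hd : IsDimensionFunction G d)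
    {S : ι → Set M} (hS : ∀ i, FinDim d (S i)) : FinDim d (⋃ i, S i) := by
  classical
  have := Fintype.ofFinite ι
  have key : ∀ s : Finset ι, FinDim d (⋃ i ∈ s, S i) := by
    intro s
    induction s using Finset.induction_on with
    | empty => simpa using hd.finDim_finite Set.finite_empty
    | insert a s _ ih =>
      rw [Finset.set_biUnion_insert]
      exact hd.finDim_union (hS a) ih
  simpa using key Finset.univ

/-- The roles of `P` and `Q` are swapped: a small change of `u` makes `P` locally dense without
altering its values on `Y`, and the density of `Q` restores agreement on the larger set. -/
theorem SomewhereDense.exchange [Finite ι] (hd : IsDimensionFunction G d)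
    {P Q : (ι → G) → G}
    (hP : SomewhereDense d P) {X Y T : Set M} {u v : ι → G} (hY : FinDim d Y)
    (hT : FinDim d T) (hQ : DenseAt d Q X Y v) (h : ∀ x ∈ Y, P u • x = Q v • x) :
    ∃ a b X' Y', FinDim d Y' ∧ T ⊆ X' ∧ T ⊆ Y' ∧
      (∀ i, ∀ x ∈ T, u i • x ∈ X') ∧ FamilyFixes X' a ∧ FamilyFixes X b ∧
      DenseAt d P X' Y' (a * u) ∧ ∀ x ∈ Y', Q (b * v) • x = P (a * u) • x := by
  obtain ⟨X₀, hX₀, hc⟩ := hP.locallyConst u Y hY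
  -- A later factor fixing `T` and every u i • T pointwise changes neither u i nor its inverse on
  -- `T`.
  have hX' : FinDim d (X₀ ∪ T ∪ ⋃ i, u i • T) :=
    hd.finDim_union (hd.finDim_union hX₀ hT) (hd.finDim_iUnion fun i => hd.finDim_smul hT _)
  obtain ⟨a, ha, Y₁, hY₁, hD⟩ := hP.dense u _ hX'
  have hY' := hd.finDim_union hY₁ hT
  obtain ⟨b, hb, hbQ⟩ := hQ (P (a * u)) (fun x hx => by
    rw [hc a (ha.mono fun x hx => Or.inl (Or.inl hx)) x hx, h x hx]) _ hY'
  exact ⟨a, b, _, _, hY', fun x hx => Or.inl (Or.inr hx), Set.subset_union_right,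
    fun i x hx => Or.inr (Set.mem_iUnion.2 ⟨i, Set.smul_mem_smul_set hx⟩), ha, hb,
    hD.mono Set.subset_union_left, hbQ⟩

/-- A stage of the construction of `u` and `v` with `P u = Q v`. -/
structure IsStage (d : Finset M → ℤ) (P Q : (ι → G) → G) (T X Y : Set M) (u v : ι → G) :
    Prop where
  finDim_right : FinDim d Y
  subset_left : T ⊆ X
  subset_right : T ⊆ Y
  smul_mem : ∀ i, ∀ x ∈ T, v i • x ∈ X
  dense : DenseAt d Q X Y v
  eq : ∀ x ∈ Y, P u • x = Q v • x

/-- Two exchanges return `P` and `Q` to their original roles, with agreement extended to `T'` and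
the values on `T` preserved. -/
theorem IsStage.next [Finite ι] (hd : IsDimensionFunction G d) {P Q : (ι → G) → G}
    (hP : SomewhereDense d P) (hQ : SomewhereDense d Q) {T T' X Y : Set M} {u v : ι → G}
    (h : IsStage d P Q T X Y u v) (hT' : FinDim d T') (hTT' : T ⊆ T') :
    ∃ u' v' X' Y', IsStage d P Q T' X' Y' u' v' ∧
      (∀ i, ∀ x ∈ T, u' i • x = u i • x ∧ (u' i)⁻¹ • x = (u i)⁻¹ • x) ∧
      (∀ i, ∀ x ∈ T, v' i • x = v i • x ∧ (v' i)⁻¹ • x = (v i)⁻¹ • x) := by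
  obtain ⟨a, b, X₁, Y₁, hY₁, hTX₁, -, huX₁, ha, hb, hD, he⟩ :=
    hP.exchange hd h.finDim_right (hT'.mono hTT') h.dense h.eq
  obtain ⟨a', b', X₂, Y₂, hY₂, hTX₂, hTY₂, hvX₂, ha', hb', hD', he'⟩ :=
    hQ.exchange hd hY₁ hT' hD he
  refine ⟨b' * (a * u), a' * (b * v), X₂, Y₂,
    ⟨hY₂, hTX₂, hTY₂, fun i x hx => ?_, hD', he'⟩,
    fun i x hx => ⟨?_, ?_⟩, fun i x hx => ⟨?_, ?_⟩⟩
  · rw [Pi.mul_apply, mul_smul, ha'.smul_eq i (hvX₂ i x hx)]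
    exact hvX₂ i x hx
  · simp only [Pi.mul_apply, mul_smul]
    rw [ha.smul_eq i (huX₁ i x hx), hb'.smul_eq i (huX₁ i x hx)]
  · simp only [Pi.mul_apply, mul_smul, mul_inv_rev]
    rw [hb'.inv_smul_eq i (hTX₁ hx), ha.inv_smul_eq i (hTX₁ hx)]
  · have h₁ := hvX₂ i x (hTT' hx)
    rw [Pi.mul_apply, mul_smul, ha'.smul_eq i h₁, Pi.mul_apply, mul_smul,
      hb.smul_eq i (h.smul_mem i x hx)]
  · simp only [Pi.mul_apply, mul_smul, mul_inv_rev]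
    rw [ha'.inv_smul_eq i (hTX₂ (hTT' hx)), hb.inv_smul_eq i (h.subset_left hx)]

theorem exists_monotone_finite_cover (M : Type*) [Countable M] :
    ∃ T : ℕ → Set M, Monotone T ∧ (∀ n, (T n).Finite) ∧ ∀ x, ∃ n, x ∈ T n := by
  obtain ⟨f, hf⟩ := Countable.exists_injective_nat M
  exact ⟨fun n => f ⁻¹' Set.Iic n, fun m n h x hx => le_trans hx h,
    fun n => (Set.finite_Iic n).preimage hf.injOn, fun x => ⟨f x, le_refl (f x)⟩⟩

/-- Stages along a finite exhaustion of `M` freeze `u`, `v` and their inverses on ever larger sets.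
The limits lie in `G` by closedness, and `P`, `Q` agree there by continuity. -/
theorem SomewhereDense.exists_eq [Finite ι] [Countable M] [FaithfulSMul G M]
    (hd : IsDimensionFunction G d)
    (hG : IsClosedAction G M) {P Q : (ι → G) → G} (hP : SomewhereDense d P)
    (hQ : SomewhereDense d Q) {X Y : Set M} {u v : ι → G} (hY : FinDim d Y)
    (hD : DenseAt d Q X Y v) (he : ∀ x ∈ Y, P u • x = Q v • x) : ∃ u v, P u = Q v := by
  obtain ⟨T, hTmono, hTfin, hTu⟩ := exists_monotone_finite_cover M
  have hT : ∀ n, FinDim d (T n) := fun n => hd.finDim_finite (hTfin n)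
  obtain ⟨u₀, v₀, X₀, Y₀, h₀⟩ : ∃ u v X Y, IsStage d P Q (T 0) X Y u v := by
    have h : IsStage d P Q ∅ X Y u v := ⟨hY, by simp, by simp, by simp, hD, he⟩
    obtain ⟨u', v', X', Y', h', -⟩ := h.next hd hP hQ (hT 0) (by simp)
    exact ⟨u', v', X', Y', h'⟩
  let Stage (n : ℕ) := {s : ((ι → G) × (ι → G)) × (Set M × Set M) //
    IsStage d P Q (T n) s.2.1 s.2.2 s.1.1 s.1.2}
  have hstep : ∀ n (s : Stage n), ∃ s' : Stage (n + 1),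
      (∀ i, ∀ x ∈ T n, s'.1.1.1 i • x = s.1.1.1 i • x ∧
        (s'.1.1.1 i)⁻¹ • x = (s.1.1.1 i)⁻¹ • x) ∧
      (∀ i, ∀ x ∈ T n, s'.1.1.2 i • x = s.1.1.2 i • x ∧
        (s'.1.1.2 i)⁻¹ • x = (s.1.1.2 i)⁻¹ • x) := by
    intro n s
    obtain ⟨u', v', X', Y', h', h₁, h₂⟩ := s.2.next hd hP hQ (hT (n + 1)) (hTmono n.le_succ)
    exact ⟨⟨((u', v'), (X', Y')), h'⟩, h₁, h₂⟩
  choose F hF₁ hF₂ using hstep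
  let s : ∀ n, Stage n := fun n => Nat.rec ⟨((u₀, v₀), (X₀, Y₀)), h₀⟩ (fun n s => F n s) n
  have hlu : ∀ i, ∃ g : G, ∀ x : M, ∀ᶠ n in atTop, (s n).1.1.1 i • x = g • x := fun i =>
    hG.exists_limit hTmono hTu (fun n => (s n).1.1.1 i) fun n x hx => hF₁ n (s n) i x hx
  have hlv : ∀ i, ∃ g : G, ∀ x : M, ∀ᶠ n in atTop, (s n).1.1.2 i • x = g • x := fun i =>
    hG.exists_limit hTmono hTu (fun n => (s n).1.1.2 i) fun n x hx => hF₂ n (s n) i x hx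
  choose u' hu' using hlu
  choose v' hv' using hlv
  refine ⟨u', v', FaithfulSMul.eq_of_smul_eq_smul fun x : M => ?_⟩
  obtain ⟨N, hN⟩ := hTu x
  obtain ⟨n, hn₁, hn₂, hn⟩ := ((hP.tendsto (fun n => (s n).1.1.1) u' hu' x).and
    ((hQ.tendsto (fun n => (s n).1.1.2) v' hv' x).and (eventually_ge_atTop N))).exists
  rw [← hn₁, ← hn₂]
  exact (s n).2.eq x ((s n).2.subset_right (hTmono hn hN))

/-- Agreement of `r` with k (P u)⁻¹ on P u • Y amounts to agreement of r⁻¹k with P u on `Y`. -/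
theorem DenseAt.mul_inv (hd : IsDimensionFunction G d) {P : (ι → G) → G} {X Y : Set M}
    {u : ι → G} (h : DenseAt d P X Y u) (k : G) :
    DenseAt d (fun u => k * (P u)⁻¹) X (P u • Y) u := by
  intro r hr B hB
  obtain ⟨b, hb, h'⟩ := h (r⁻¹ * k) (fun x hx => by
    have := hr _ (Set.smul_mem_smul_set hx)
    rw [mul_smul, inv_smul_smul] at this
    rw [mul_smul, ← this, inv_smul_smul]) (k⁻¹ • r • B) (hd.finDim_smul (hd.finDim_smul hB _) _)
  refine ⟨b, hb, fun x hx => ?_⟩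
  have := h' _ (Set.smul_mem_smul_set (Set.smul_mem_smul_set hx))
  rw [mul_smul, smul_inv_smul, inv_smul_smul] at this
  change (k * (P (b * u))⁻¹) • x = r • x
  conv_lhs => rw [← this]
  simp [mul_smul]

theorem SomewhereDense.mul_inv (hd : IsDimensionFunction G d) {P : (ι → G) → G}
    (hP : SomewhereDense d P) (k : G) : SomewhereDense d (fun u => k * (P u)⁻¹) where
  dense u X hX := by
    obtain ⟨a, ha, Y, hY, h⟩ := hP.dense u X hX
    exact ⟨a, ha, _, hd.finDim_smul hY _, h.mul_inv hd k⟩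
  locallyConst u B hB := by
    obtain ⟨X, hX, h⟩ := hP.locallyConst u ((P u)⁻¹ • B) (hd.finDim_smul hB _)
    refine ⟨X, hX, fun a ha x hx => ?_⟩
    have := h a ha _ (Set.smul_mem_smul_set hx)
    rw [smul_inv_smul] at this
    change (k * (P (a * u))⁻¹) • x = (k * (P u)⁻¹) • x
    rw [mul_smul, mul_smul, inv_smul_eq_iff.2 this.symm]
  tendsto u v h := eventually_mul_smul (u := fun _ => k) (fun x => by simp)
    (eventually_inv_smul (hP.tendsto u v h))

end Alternation


/-! ### Local density of products of four conjugates, and factorization into eight. -/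

section ConjProd

variable {G M : Type*} [Group G] [MulAction G M] {d : Finset M → ℤ}

/-- The product of four conjugates of `g`. -/
def conjProd (g : G) (u : Fin 4 → G) : G :=
  (u 3 * g * (u 3)⁻¹) * (u 2 * g * (u 2)⁻¹) * (u 1 * g * (u 1)⁻¹) * (u 0 * g * (u 0)⁻¹)

theorem conjProd_smul (g : G) (u : Fin 4 → G) (x : M) :
    conjProd g u • x = (u 3 * g * (u 3)⁻¹) • (u 2 * g * (u 2)⁻¹) • (u 1 * g * (u 1)⁻¹) •
      (u 0 * g * (u 0)⁻¹) • x := by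
  rw [conjProd]
  simp only [mul_smul]

theorem conjProd_const_mul (g s : G) (u : Fin 4 → G) :
    conjProd g ((fun _ => s) * u) = s * conjProd g u * s⁻¹ := by
  simp only [conjProd, Pi.mul_apply]
  group

theorem conjProd_tendsto (g : G) (u : ℕ → Fin 4 → G) (v : Fin 4 → G)
    (h : ∀ i (x : M), ∀ᶠ n in atTop, u n i • x = v i • x) (x : M) :
    ∀ᶠ n in atTop, conjProd g (u n) • x = conjProd g v • x := by
  have hc : ∀ i (x : M), ∀ᶠ n in atTop, (u n i * g * (u n i)⁻¹) • x = (v i * g * (v i)⁻¹) • x :=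
    fun i => eventually_mul_smul (eventually_mul_smul (v := fun _ => g) (h i) (fun x => by simp))
      (eventually_inv_smul (h i))
  exact eventually_mul_smul (eventually_mul_smul (eventually_mul_smul (hc 3) (hc 2)) (hc 1))
    (hc 0) x

theorem conj_conj_smul {X : Set M} {a p : G} (ha : a ∈ fixingSubgroup G X) {x : M} (hx : x ∈ X)
    (hpx : p • x ∈ X) : (a * p * a⁻¹) • x = p • x := by
  have ha' := inv_mem ha
  rw [mem_fixingSubgroup_iff] at ha ha'
  rw [mul_smul, ha' x hx, mul_smul, ha _ hpx]

variable [DecidableEq M]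

theorem conjProd_locallyConst (hd : IsDimensionFunction G d) (g : G) (u : Fin 4 → G) (B : Set M)
    (hB : FinDim d B) : ∃ X, FinDim d X ∧
      ∀ a, FamilyFixes X a → ∀ x ∈ B, conjProd g (a * u) • x = conjProd g u • x := by
  let p : Fin 4 → G := fun i => u i * g * (u i)⁻¹
  refine ⟨B ∪ p 0 • B ∪ p 1 • p 0 • B ∪ p 2 • p 1 • p 0 • B ∪ p 3 • p 2 • p 1 • p 0 • B,
    hd.finDim_union (hd.finDim_union (hd.finDim_union (hd.finDim_union hB ?_) ?_) ?_) ?_,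
    fun a ha x hx => ?_⟩
  · exact hd.finDim_smul hB _
  · exact hd.finDim_smul (hd.finDim_smul hB _) _
  · exact hd.finDim_smul (hd.finDim_smul (hd.finDim_smul hB _) _) _
  · exact hd.finDim_smul (hd.finDim_smul (hd.finDim_smul (hd.finDim_smul hB _) _) _) _
  · have m₀ : p 0 • x ∈ p 0 • B := Set.smul_mem_smul_set hx
    have m₁ : p 1 • p 0 • x ∈ p 1 • p 0 • B := Set.smul_mem_smul_set m₀
    have m₂ : p 2 • p 1 • p 0 • x ∈ p 2 • p 1 • p 0 • B := Set.smul_mem_smul_set m₁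
    have m₃ : p 3 • p 2 • p 1 • p 0 • x ∈ p 3 • p 2 • p 1 • p 0 • B := Set.smul_mem_smul_set m₂
    -- Conjugating by an element that fixes a point and its image does not change the value at that
    -- point.
    have q : ∀ i y, y ∈ _ → p i • y ∈ _ → ((a * u) i * g * ((a * u) i)⁻¹) • y = p i • y :=
      fun i y hy hpy => by
        rw [← conj_conj_smul (ha i) hy hpy]
        simp [p, mul_assoc]
    rw [conjProd_smul, conjProd_smul, q 0 x (by simp [hx]) (by simp [m₀]),
      q 1 _ (by simp [m₀]) (by simp [m₁]), q 2 _ (by simp [m₁]) (by simp [m₂]),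
      q 3 _ (by simp [m₂]) (by simp [m₃])]

/-- Only the outer conjugators need a perturbation: over Y₁ and Y₃ they are moved so that Y₀ and Y₄
become independent from Y₂, the hypotheses of `exists_conj_prod_eq`. -/
theorem conjProd_dense (hd : IsDimensionFunction G d) (hex : HasExistence G d)
    (hst : IsStationary G d) {g : G} {A : Set M} (hA : FinDim d A) (hg : MovesMaximally d g A)
    (u : Fin 4 → G) (X : Set M) (hX : FinDim d X) :
    ∃ a, FamilyFixes X a ∧ ∃ Y, FinDim d Y ∧ DenseAt d (conjProd g) X Y (a * u) := by
  have hp : ∀ i, MovesMaximally d (u i * g * (u i)⁻¹) (u i • A) := fun i => hg.conj hd _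
  have hp' : MovesMaximally d (u 3 * g * (u 3)⁻¹)⁻¹ (u 3 • g • A) := by
    have := (hg.inv hd).conj hd (u 3)
    convert this using 1
    group
  set p : Fin 4 → G := fun i => u i * g * (u i)⁻¹ with hpdef
  set W := X ∪ (u 0 • A ∪ u 1 • A ∪ u 2 • A ∪ u 3 • g • A) with hWdef
  have hW : FinDim d W := hd.finDim_union hX (hd.finDim_union (hd.finDim_union (hd.finDim_union
    (hd.finDim_smul hA _) (hd.finDim_smul hA _)) (hd.finDim_smul hA _))
    (hd.finDim_smul (hd.finDim_smul hA _) _))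
  have m₀ : MovesMaximally d (p 0) W := (hp 0).mono
    (by rw [hWdef]; intro x; simp only [Set.mem_union]; tauto)
  have m₁ : MovesMaximally d (p 1) W := (hp 1).mono
    (by rw [hWdef]; intro x; simp only [Set.mem_union]; tauto)
  have m₂ : MovesMaximally d (p 2) W := (hp 2).mono
    (by rw [hWdef]; intro x; simp only [Set.mem_union]; tauto)
  have m₃ : MovesMaximally d (p 3)⁻¹ W := hp'.mono
    (by rw [hWdef]; intro x; simp only [Set.mem_union]; tauto)
  have hXW : X ⊆ W := Set.subset_union_left
  have hY₂W := hd.finDim_union (hd.finDim_smul hW (p 1)) (hd.finDim_smul hW (p 2)⁻¹)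
  -- The middle set is chosen first and large enough that both its neighbours contain `W`; fixing
  -- either of them then fixes `X`.
  obtain ⟨Y₂, hY₂, hW₁, hW₃⟩ : ∃ Y₂ ∈ finClosures d, W ⊆ (p 1)⁻¹ • Y₂ ∧ W ⊆ p 2 • Y₂ := by
    refine ⟨_, hd.dcl_mem hY₂W, ?_, ?_⟩
    · rw [← Set.smul_set_subset_iff_subset_inv_smul_set]
      exact Set.subset_union_left.trans (hd.subset_dcl _)
    · rw [Set.subset_smul_set_iff]
      exact Set.subset_union_right.trans (hd.subset_dcl _)
  obtain ⟨Y₁, e₁⟩ : ∃ Y₁, Y₁ = (p 1)⁻¹ • Y₂ := ⟨_, rfl⟩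
  obtain ⟨Y₃, e₃⟩ : ∃ Y₃, Y₃ = p 2 • Y₂ := ⟨_, rfl⟩
  have hY₁ : Y₁ ∈ finClosures d := e₁ ▸ hd.smul_mem _ hY₂
  have hY₃ : Y₃ ∈ finClosures d := e₃ ▸ hd.smul_mem _ hY₂
  rw [← e₁] at hW₁
  rw [← e₃] at hW₃
  have f₁ := hd.finDim_of_mem hY₁
  have f₂ := hd.finDim_of_mem hY₂
  have f₃ := hd.finDim_of_mem hY₃
  have f₀ := hd.finDim_smul f₁ (p 0)⁻¹
  have f₄ := hd.finDim_smul f₃ (p 3)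
  obtain ⟨a₀, ha₀, h₀⟩ := hd.exists_indep hex f₀ f₁ f₂
  obtain ⟨a₃, ha₃, h₃⟩ := hd.exists_indep hex f₄ f₃ f₂
  rw [← hd.rk_smul (hd.finDim_union f₀ f₁) a₀, Set.smul_set_union,
    smul_set_eq_of_fixing ha₀] at h₀
  rw [← hd.rk_smul (hd.finDim_union f₄ f₃) a₃, Set.smul_set_union,
    smul_set_eq_of_fixing ha₃] at h₃
  have ha₀' := inv_mem ha₀
  have ha₃' := inv_mem ha₃
  have n₀ := m₀.conj hd a₀
  rw [smul_set_eq_of_fixing (fixingSubgroup_le hW₁ ha₀)] at n₀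
  have n₃ := m₃.conj hd a₃
  rw [smul_set_eq_of_fixing (fixingSubgroup_le hW₃ ha₃),
    show a₃ * (p 3)⁻¹ * a₃⁻¹ = (a₃ * p 3 * a₃⁻¹)⁻¹ by group] at n₃
  refine ⟨![a₀, 1, 1, a₃], ?_, a₀ • (p 0)⁻¹ • Y₁, hd.finDim_smul f₀ _, ?_⟩
  · intro i
    fin_cases i
    · exact fixingSubgroup_le (hXW.trans hW₁) ha₀
    · exact one_mem _
    · exact one_mem _
    · exact fixingSubgroup_le (hXW.trans hW₃) ha₃
  intro r hr B hB
  obtain ⟨b₀, hb₀, b₁, hb₁, b₂, hb₂, b₃, hb₃, h⟩ := exists_conj_prod_eq hd hex hst n₀ m₁ m₂ n₃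
    (Y₀ := a₀ • (p 0)⁻¹ • Y₁) (Y₁ := Y₁) (Y₂ := Y₂) (Y₃ := Y₃) (Y₄ := a₃ • p 3 • Y₃)
    (hd.smul_mem _ (hd.smul_mem _ hY₁)) (by simp [mul_smul, smul_set_eq_of_fixing ha₀])
    (by rw [e₁, smul_inv_smul]) e₃.symm (by simp [mul_smul, smul_set_eq_of_fixing ha₃'])
    hW₁ hW₃ h₀ h₃ (r := r) (by
      intro x hx
      rw [hr x hx]
      simp [conjProd, hpdef, mul_assoc]) hB
  refine ⟨![b₀, b₁, b₂, b₃], ?_, fun x hx => ?_⟩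
  · intro i
    fin_cases i
    · exact fixingSubgroup_le (hXW.trans hW₁) hb₀
    · exact fixingSubgroup_le (hXW.trans hW₁) hb₁
    · exact fixingSubgroup_le (hXW.trans hW₃) hb₂
    · exact fixingSubgroup_le (hXW.trans hW₃) hb₃
  · rw [← h x hx]
    simp [conjProd, hpdef, mul_assoc]

theorem conjProd_somewhereDense (hd : IsDimensionFunction G d) (hex : HasExistence G d)
    (hst : IsStationary G d) {g : G} {A : Set M} (hA : FinDim d A) (hg : MovesMaximally d g A) :
    SomewhereDense d (conjProd g) where
  dense := conjProd_dense hd hex hst hA hg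
  locallyConst := conjProd_locallyConst hd g
  tendsto := conjProd_tendsto g

/-- Multiplying all four conjugators on the left by `s` conjugates the product by `s`. -/
theorem DenseAt.conj (hd : IsDimensionFunction G d) {g : G} {Y : Set M} {u : Fin 4 → G}
    (h : DenseAt d (conjProd g) ∅ Y u) (s : G) :
    DenseAt d (conjProd g) ∅ (s • Y) ((fun _ => s) * u) := by
  intro r hr B hB
  obtain ⟨b, -, h'⟩ := h (s⁻¹ * r * s) (fun x hx => by
    have := hr _ (Set.smul_mem_smul_set hx)
    rw [conjProd_const_mul, mul_smul, inv_smul_smul, mul_smul] at this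
    rw [mul_smul, mul_smul, this, inv_smul_smul]) (s⁻¹ • B) (hd.finDim_smul hB _)
  refine ⟨fun i => s * b i * s⁻¹, fun i => by simp, fun x hx => ?_⟩
  have e : (fun i => s * b i * s⁻¹) * ((fun _ => s) * u) = (fun _ => s) * (b * u) := by
    ext i
    simp [mul_assoc]
  have := h' _ (Set.smul_mem_smul_set hx)
  rw [e, conjProd_const_mul, mul_smul, mul_smul, this]
  simp [mul_smul]

theorem IsDimensionFunction.rk_add_le_of_subset (hd : IsDimensionFunction G d)
    {S T S' T' : Set M} (hS : FinDim d S) (hT : FinDim d T)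
    (h : rk d S + rk d T ≤ rk d (S ∪ T)) (hS' : S' ⊆ S) (hT' : T' ⊆ T) :
    rk d S' + rk d T' ≤ rk d (S' ∪ T') := by
  have i₁ := hd.rk_submodular (S := S ∪ T') (T := T) (U := T')
    (hd.finDim_union hS (hT.mono hT')) hT Set.subset_union_right hT'
  have i₂ := hd.rk_submodular (S := S' ∪ T') (T := S) (U := S')
    (hd.finDim_union (hS.mono hS') (hT.mono hT')) hS Set.subset_union_left hS'
  rw [Set.union_assoc, Set.union_eq_right.2 hT'] at i₁
  rw [Set.union_right_comm, Set.union_eq_right.2 hS'] at i₂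
  linarith

/-- If `g` moves types maximally and `G` fixes the closure of the empty set, then every element of
`G` is a product of eight conjugates of `g`. -/
theorem MovesMaximally.exists_conjProd_mul_conjProd [Countable M] [FaithfulSMul G M]
    (hd : IsDimensionFunction G d) (hG : IsClosedAction G M) (hex : HasExistence G d)
    (hst : IsStationary G d) (hfix : ∀ (f : G), ∀ x ∈ dcl d ∅, f • x = x)
    {g : G} {A : Set M} (hA : FinDim d A) (hg : MovesMaximally d g A) (k : G) :
    ∃ u v, conjProd g u * conjProd g v = k := by
  have hP := conjProd_somewhereDense hd hex hst hA hg
  have he := hd.finDim_finite Set.finite_empty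
  have rk_empty : rk d (∅ : Set M) = 0 := by
    have := hd.rk_finset ∅
    rwa [Finset.coe_empty, hd.empty] at this
  obtain ⟨a, -, Y, hY, hD⟩ := hP.dense 1 ∅ he
  set p := conjProd g (a * 1) with hp
  have hpY := hd.finDim_smul hY p
  have hkpY := hd.finDim_smul hpY k⁻¹
  have hW := hd.finDim_union hY hpY
  have hV := hd.finDim_union hY hkpY
  -- Conjugating by this `s` places the data for k (P v)⁻¹ independently from those for P u, which
  -- makes the two local conditions compatible.
  obtain ⟨s, -, hs⟩ := hd.exists_indep hex hW he hV
  rw [Set.union_empty, Set.union_empty, Set.empty_union, rk_empty, add_zero,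
    ← hd.rk_smul hW s] at hs
  have hsW := hd.finDim_smul hW s
  have hDs := (hD.conj hd s).mul_inv hd k
  rw [conjProd_const_mul, ← hp, mul_smul, inv_smul_smul, mul_smul] at hDs
  have hZ := hd.finDim_smul hpY s
  have i₁ := hd.rk_add_le_of_subset hsW hV hs (S' := s • p • Y) (T' := Y)
    (Set.smul_set_mono Set.subset_union_right) Set.subset_union_left
  have i₂ := hd.rk_add_le_of_subset hsW hV hs (S' := s • Y) (T' := k⁻¹ • p • Y)
    (Set.smul_set_mono Set.subset_union_left) Set.subset_union_right
  have hsY := hd.finDim_smul hY s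
  rw [← hd.rk_smul (hd.finDim_union hsY hkpY) (p⁻¹ * k), Set.smul_set_union, hd.rk_smul hY,
    hd.rk_smul hpY, hd.rk_smul hY, mul_smul p⁻¹ k, mul_smul p⁻¹ k, smul_inv_smul,
    inv_smul_smul] at i₂
  -- An element is sought that equals `p` on `Y` and k (s p s⁻¹)⁻¹ on s p Y. It is p w, where `w` is
  -- the identity on `Y` and `t` on s p Y; stationarity over the closure of ∅, which `t` fixes by
  -- `hfix`, yields `w`.
  set t := p⁻¹ * (k * (s * p * s⁻¹)⁻¹) with ht
  have htZ : t • s • p • Y = p⁻¹ • k • s • Y := by simp [ht, mul_smul]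
  have hcl := hd.finDim_dcl he
  have hZcl := hd.finDim_union hZ hcl
  have eZ : rk d (s • p • Y ∪ dcl d ∅) = rk d Y := by
    rw [hd.rk_union_dcl he hZ, Set.union_empty, hd.rk_smul hpY, hd.rk_smul hY]
  have eY : rk d (dcl d ∅ ∪ Y) = rk d Y := by rw [hd.rk_dcl_union he hY, Set.empty_union]
  have ecl : rk d (dcl d ∅) = 0 := by rw [hd.rk_dcl he, rk_empty]
  obtain ⟨w, hw, hwY⟩ := hd.exists_extension hst hZcl (hd.dcl_mem he) hY
    Set.subset_union_right t ((mem_fixingSubgroup_iff G).2 (hfix t))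
    (by
      rw [eZ, eY, ecl, add_zero]
      rw [hd.rk_smul hpY, hd.rk_smul hY] at i₁
      exact i₁.trans ((hd.finDim_union hZcl hY).rk_mono
        (by intro x; simp only [Set.mem_union]; tauto)))
    (by
      rw [eZ, eY, ecl, add_zero, Set.smul_set_union, htZ]
      have hf := hd.finDim_smul (hd.finDim_smul hsY k) p⁻¹
      exact i₂.trans ((hd.finDim_union (hd.finDim_union hf (hd.finDim_smul hcl t)) hY).rk_mono
        (by intro x; simp only [Set.mem_union]; tauto)))
  obtain ⟨b, -, hb⟩ := hD (p * w) (fun x hx => by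
    rw [mul_smul, (mem_fixingSubgroup_iff G).1 hwY x hx]) _ hZ
  obtain ⟨u, v, huv⟩ := hP.exists_eq hd hG (hP.mul_inv hd k) hZ hDs (u := b * (a * 1)) (by
    intro x hx
    rw [hb x hx, mul_smul, hw x (Or.inl hx), ht, mul_smul, smul_inv_smul, conjProd_const_mul])
  exact ⟨u, v, by rw [huv, inv_mul_cancel_right]⟩

end ConjProd


/-! ### Passage to the pointwise stabilizer of the closure of the empty set. -/

section Restriction

variable {G M : Type*} [Group G] [MulAction G M] {d : Finset M → ℤ}

theorem IsClosedAction.fixingSubgroup (hG : IsClosedAction G M) (S : Set M) :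
    IsClosedAction (fixingSubgroup G S) M := by
  intro u h₁ h₂
  obtain ⟨g, hg⟩ := hG (fun n => (u n : G)) h₁ h₂
  refine ⟨⟨g, (mem_fixingSubgroup_iff G).2 fun x hx => ?_⟩, hg⟩
  obtain ⟨n, hn⟩ := (hg x).exists
  rw [← hn]
  exact (mem_fixingSubgroup_iff G).1 (u n).2 x hx

theorem mem_fixingSubgroup_fixingSubgroup {S X : Set M} {a : fixingSubgroup G S} :
    a ∈ fixingSubgroup (fixingSubgroup G S) X ↔ (a : G) ∈ fixingSubgroup G X := by
  rw [mem_fixingSubgroup_iff, mem_fixingSubgroup_iff]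
  rfl

theorem MovesMaximally.restrict {S A : Set M} {g : fixingSubgroup G S}
    (hg : MovesMaximally d (g : G) A) (hA : S ⊆ A) : MovesMaximally d g A := by
  intro X hX hAX B hB hXB
  obtain ⟨a, ha, h⟩ := hg X hX hAX B hB hXB
  exact ⟨⟨a, fixingSubgroup_le (hA.trans hAX) ha⟩, mem_fixingSubgroup_fixingSubgroup.2 ha, h⟩

variable [DecidableEq M]

theorem IsDimensionFunction.restrict (hd : IsDimensionFunction G d) (N : Subgroup G) :
    IsDimensionFunction N d where
  invariant g X := hd.invariant (g : G) X
  nonneg := hd.nonneg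
  mono := hd.mono
  submodular := hd.submodular
  empty := hd.empty

theorem IsDimensionFunction.dcl_empty_subset (hd : IsDimensionFunction G d) {A : Set M}
    (hA : A ∈ finClosures d) : dcl d ∅ ⊆ A := by
  rw [← hd.dcl_eq_self hA]
  exact hd.dcl_mono (Set.empty_subset A)

/-- Every closed set contains the closure of ∅, so an automorphism fixing a closed set pointwise
already lies in the subgroup. -/
theorem HasExistence.restrict (hd : IsDimensionFunction G d) (hex : HasExistence G d) :
    HasExistence (fixingSubgroup G (dcl d ∅)) d := by
  intro A hA B hB C hC
  obtain ⟨g, hg, h⟩ := hex A hA B hB C hC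
  exact ⟨⟨g, fixingSubgroup_le (hd.dcl_empty_subset hB) hg⟩,
    mem_fixingSubgroup_fixingSubgroup.2 hg, h⟩

theorem IsStationary.restrict (hd : IsDimensionFunction G d) (hst : IsStationary G d) :
    IsStationary (fixingSubgroup G (dcl d ∅)) d := by
  intro A₁ hA₁ A₂ hA₂ B hB C hC h₁ h₂ i₁ i₂ h hh hB'
  obtain ⟨k, hk, hkC⟩ := hst A₁ hA₁ A₂ hA₂ B hB C hC h₁ h₂ i₁ i₂ h hh hB'
  exact ⟨⟨k, (mem_fixingSubgroup_iff G).2 fun x hx => hkC x (hd.dcl_empty_subset hC hx)⟩, hk, hkC⟩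

/-- Every element of the pointwise stabilizer of the closure of the empty set is a product of eight
conjugates of an unbounded element. -/
theorem IsUnbounded.exists_conjProd_mul_conjProd [Countable M] [FaithfulSMul G M]
    (hd : IsDimensionFunction G d) (hG : IsClosedAction G M) (hex : HasExistence G d)
    (hst : IsStationary G d) {A D : Set M} (hA : A ∈ finClosures d)
    (hD_inv : ∀ f ∈ fixingSubgroup G A, ∀ x ∈ D, f • x ∈ D)
    (hD_basic : ∀ x ∈ D \ A, IsBasic d A x) (hD_cl : dcl d (D ∪ A) = Set.univ)
    {g : fixingSubgroup G (dcl d ∅)} (hg : IsUnbounded d (g : G))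
    (k : fixingSubgroup G (dcl d ∅)) : ∃ u v, conjProd g u * conjProd g v = k := by
  obtain ⟨A₀, hA₀, hg⟩ := hg
  have hA' := hd.finDim_of_mem hA
  have hm := hg.movesMaximally hd hex hA' hD_inv hD_basic hD_cl
  exact (hm.restrict ((hd.dcl_empty_subset hA).trans Set.subset_union_left)
    ).exists_conjProd_mul_conjProd (hd.restrict _) (hG.fixingSubgroup _) (hex.restrict hd)
    (hst.restrict hd) (fun f x hx => (mem_fixingSubgroup_iff G).1 f.2 x hx)
    (hd.finDim_union hA' (hd.finDim_of_mem hA₀)) k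

end Restriction

/-! ### Automorphism groups act faithfully and are closed under limits. -/

section Automorphisms

variable {L : FirstOrder.Language.{u, v}} {M : Type w} [L.Structure M]

instance faithfulSMul_aut : FaithfulSMul (L.Equiv M M) M :=
  ⟨fun h => FirstOrder.Language.Equiv.ext h⟩

/-- A pointwise limit of automorphisms whose inverses converge is an automorphism. -/
theorem isClosedAction_aut : IsClosedAction (L.Equiv M M) M := by
  intro u h₁ h₂
  choose f hf using h₁
  choose f' hf' using h₂
  refine ⟨{ toFun := f, invFun := f', left_inv := fun x => ?_, right_inv := fun x => ?_,
            map_fun' := fun {n} F x => ?_, map_rel' := fun {n} R x => ?_ }, hf⟩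
  · obtain ⟨n, h, h'⟩ := ((hf x).and (hf' (f x))).exists
    rw [← h', ← h, inv_smul_smul]
  · obtain ⟨n, h, h'⟩ := ((hf' x).and (hf (f' x))).exists
    rw [← h', ← h, smul_inv_smul]
  -- Arities are finite, so a single `u m` agrees with the limit on all arguments and on the value.
  · obtain ⟨m, h, h'⟩ := ((eventually_all.2 fun i => hf (x i)).and
      (hf (FirstOrder.Language.Structure.funMap F x))).exists
    have e : f ∘ x = u m ∘ x := funext fun i => (h i).symm
    rw [← h', e]
    exact (u m).map_fun F x
  · obtain ⟨m, h⟩ := (eventually_all.2 fun i => hf (x i)).exists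
    have e : f ∘ x = u m ∘ x := funext fun i => (h i).symm
    change FirstOrder.Language.Structure.RelMap R (f ∘ x) ↔ _
    rw [e]
    exact (u m).map_rel R x

end Automorphisms

end DimensionIndependence

theorem theorem3p10 {L : FirstOrder.Language.{u, v}} {M : Type w} [L.Structure M] [Countable M]
    [DecidableEq M] (d : Finset M → ℤ)
    (hd : DimensionIndependence.IsDimensionFunction (L.Equiv M M) d)
    (hd_ne : d ≠ 0)
    (hdcl : DimensionIndependence.SubsumesDefinableClosure (L.Equiv M M) d)
    (hex : DimensionIndependence.HasExistence (L.Equiv M M) d)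
    (hst : DimensionIndependence.IsStationary (L.Equiv M M) d)
    (A : Set M) (hA : A ∈ DimensionIndependence.finClosures d)
    (D : Set M)
    (hD_inv : ∀ f ∈ fixingSubgroup (L.Equiv M M) A, ∀ x ∈ D, f • x ∈ D)
    (hD_basic : ∀ x ∈ D \ A, DimensionIndependence.IsBasic d A x)
    (hD_cl : DimensionIndependence.dcl d (D ∪ A) = Set.univ)
    (g : fixingSubgroup (L.Equiv M M) (DimensionIndependence.dcl d ∅))
    (hg : DimensionIndependence.IsUnbounded d (g : L.Equiv M M)) :
    ∀ k : fixingSubgroup (L.Equiv M M) (DimensionIndependence.dcl d ∅),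
      ∃ l : List (fixingSubgroup (L.Equiv M M) (DimensionIndependence.dcl d ∅)),
        l.length = 96 ∧ (∀ x ∈ l, IsConj g x ∨ IsConj g⁻¹ x) ∧ l.prod = k := by
  intro k
  -- Since 96 = 8 + 88, the eight-conjugate factorization is applied to k g⁻⁸⁸ and followed by 88
  -- copies of `g`; only conjugates of `g` itself occur.
  obtain ⟨u, v, huv⟩ := hg.exists_conjProd_mul_conjProd hd
    DimensionIndependence.isClosedAction_aut hex hst hA hD_inv hD_basic hD_cl (k * (g ^ 88)⁻¹)
  have hc : ∀ w, IsConj g (w * g * w⁻¹) := fun w => isConj_iff.2 ⟨w, rfl⟩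
  refine ⟨[u 3 * g * (u 3)⁻¹, u 2 * g * (u 2)⁻¹, u 1 * g * (u 1)⁻¹, u 0 * g * (u 0)⁻¹,
    v 3 * g * (v 3)⁻¹, v 2 * g * (v 2)⁻¹, v 1 * g * (v 1)⁻¹, v 0 * g * (v 0)⁻¹] ++
    List.replicate 88 g, by simp, fun x hx => Or.inl ?_, ?_⟩
  · rw [List.mem_append, List.mem_replicate] at hx
    rcases hx with hx | ⟨-, rfl⟩
    · simp only [List.mem_cons, List.not_mem_nil, or_false] at hx
      rcases hx with rfl | rfl | rfl | rfl | rfl | rfl | rfl | rfl <;> exact hc _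
    · exact IsConj.refl _
  · rw [List.prod_append, List.prod_replicate, ← eq_mul_inv_iff_mul_eq, ← huv]
    simp only [DimensionIndependence.conjProd, List.prod_cons, List.prod_nil, mul_one, mul_assoc]
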